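/- Let $I\in\mathbb R^{2\times2}$ be symmetric positive definite (the Fisher information of the parameter of interest $\theta_1$ and the nuisance parameter $\theta_2$, both on the boundary of the parameter space, at the true value $0$), with spectral decomposition $I=P\Lambda P^{\top}$, $P$ orthogonal, $\Lambda$ diagonal. Let $Z\sim N_2(0,I^{-1})$, let $\rho=(I^{-1})_{12}/\sqrt{(I^{-1})_{11}(I^{-1})_{22}}$ be the correlation of $Z_1$ and $Z_2$, and assume $\rho\ge0$. Put $q=\arcsin(\rho)/(2\pi)$, $\gamma=\arcsin\rho$, $W=\Lambda^{1/2}P^{\top}$ and $\tilde Z=WZ$. Let $$C_0=\{\theta_1=0,\ \theta_2\ge0\},\qquad C_1=\{\theta_1\ge0,\ \theta_2\ge0\},\qquad H=\{\theta_2\ge0\}$$ be the null cone, the (correct) quadrant alternative cone, and the half-plane alternative cone. For a cone $C$ define $$T_C(z)=\operatorname{dist}(z,WC_0)^2-\operatorname{dist}(z,WC)^2 .$$ Thus $T_{C_1}(\tilde Z)$ is the limit in law of the likelihood ratio statistic given by the standard cone approximation. Let $\chi^2_0$ be the point mass at $0$. Write $u=We_1$, $v=We_2$, and define the closed sectors $$R_1=WC_1\cap\{\langle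 z,v\rangle\le0\},\quad R_2=WC_1\cap\{\langle z,v\rangle\ge0\},\quad R_3=W\{\theta_1\le0,\ \theta_2\ge0\},$$ $$R_4=W\{\theta_2\le0\}\cap\{\langle z,u\rangle\le0\le\langle z,v\rangle\},\quad R_5=\{\langle z,u\rangle\le0,\ \langle z,v\rangle\le0\},\quad R_6=W\{\theta_2\le0\}\cap\{\langle z,u\rangle\ge0\}.$$ Then: 1. $\tilde Z\sim N_2(0,\mathbb I_2)$, and $T_{C_1}(\tilde Z)$ has the law $$\left(\tfrac12-q\right)\chi^2_0+\tfrac12\,\chi^2_1+q\,\chi^2_2 .$$ The same is the law of $\inf_{\theta\in C_0}Q(\theta\mid Z)-\inf_{\theta\in C_1}Q(\theta\mid Z)$, where $Q(\theta\mid Z)=(Z-\theta)^{\top}I(Z-\theta)$. 2. The angle between $u$ and $v$ is $\pi/2+\gamma$. The contribution to the law of $T_{C_1}(\tilde Z)$ of the event $\tilde Z\in R_1$ is $q\,\chi^2_2$, that of $\tilde Z\in R_2\cup R_6$ is $\tfrac12\chi^2_1$, and that of $\tilde Z\in R_3\cup R_4\cup R_5$ is $(\tfrac12-q)\chi^2_0$.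 In fact $T_{C_1}=0$ everywhere on $R_3\cup R_4\cup R_5$. 3. If the half-plane $H$ is taken as alternative cone instead of the quadrant, then $T_H=T_{C_1}$ on $R_1\cup R_2\cup R_6$, whereas $T_H(z)=\|z\|^2-\langle z,v\rangle^2/\|v\|^2$ on $R_3$, $T_H(z)=\langle z,u\rangle^2/\|u\|^2-\langle z,v\rangle^2/\|v\|^2$ on $R_4$, and $T_H(z)=\langle z,u\rangle^2/\|u\|^2$ on $R_5$. If $\rho>0$, the law of $T_H(\tilde Z)$ is not of the form $w_0\chi^2_0+w_1\chi^2_1+w_2\chi^2_2$ for any weights $w_0,w_1,w_2\ge0$. -/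

import Mathlib

open MeasureTheory ProbabilityTheory
open scoped Matrix

/-- The Euclidean plane. Coordinate `0` is the parameter of interest `θ₁`, coordinate `1` is the
nuisance parameter `θ₂`. -/
abbrev Plane : Type := EuclideanSpace ℝ (Fin 2)

namespace BoundaryLRT

/-- The `χ²_k` distribution: the law of the sum of squares of `k` independent standard normal
variables (the point mass at `0` for `k = 0`). -/
noncomputable def chiSq (k : ℕ) : Measure ℝ :=
  (Measure.pi fun _ : Fin k => gaussianReal 0 1).map fun x => ∑ i, x i ^ 2

/-- The mixture `w₀ χ²₀ + w₁ χ²₁ + w₂ χ²₂` for nonnegative weights. -/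
noncomputable def chiBarSq (w₀ w₁ w₂ : ℝ) : Measure ℝ :=
  ENNReal.ofReal w₀ • chiSq 0 + ENNReal.ofReal w₁ • chiSq 1 + ENNReal.ofReal w₂ • chiSq 2

/-- The correlation of the two coordinates of a vector with covariance matrix `I⁻¹`. -/
noncomputable def corr (I : Matrix (Fin 2) (Fin 2) ℝ) : ℝ :=
  I⁻¹ 0 1 / √(I⁻¹ 0 0 * I⁻¹ 1 1)

/-- `q = arcsin ρ / (2π)`. -/
noncomputable def weight (I : Matrix (Fin 2) (Fin 2) ℝ) : ℝ :=
  Real.arcsin (corr I) / (2 * Real.pi)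

/-- The null cone `θ₁ = 0`, `θ₂ ≥ 0`. -/
def nullCone : Set Plane := {θ | θ 0 = 0 ∧ 0 ≤ θ 1}

/-- The alternative cone `θ₁ ≥ 0`, `θ₂ ≥ 0`. -/
def altCone : Set Plane := {θ | 0 ≤ θ 0 ∧ 0 ≤ θ 1}

/-- The misidentified alternative cone: `θ₂ ≥ 0` with `θ₁` unrestricted. After whitening it is the
half-plane that contains the quadrant and is bounded by the line through the image of the
`θ₁`-axis. -/
def halfPlane : Set Plane := {θ | 0 ≤ θ 1}

/-- The limit statistic in untransformed coordinates: the infimum over the null cone minus the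
infimum over the alternative cone `C` of `Q(θ | z) = (z - θ)ᵀ I (z - θ)`. -/
noncomputable def quadStat (I : Matrix (Fin 2) (Fin 2) ℝ) (C : Set Plane) (z : Plane) : ℝ :=
  (⨅ θ : nullCone, (z - θ.1).ofLp ⬝ᵥ (I *ᵥ (z - θ.1).ofLp)) -
    ⨅ θ : C, (z - θ.1).ofLp ⬝ᵥ (I *ᵥ (z - θ.1).ofLp)

section Whitened

variable (l : Fin 2 → ℝ) (P : Matrix (Fin 2) (Fin 2) ℝ)

/-- The linear map `θ ↦ Λ^{1/2} Pᵀ θ`, where `Λ = diag l`. -/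
noncomputable def whiten : Plane →ₗ[ℝ] Plane :=
  Matrix.toEuclideanLin (Matrix.diagonal (fun i => √(l i)) * Pᵀ)

/-- The difference of the squared Euclidean distances from `z` to the whitened null cone and to the
whitened alternative cone. -/
noncomputable def distStat (C : Set Plane) (z : Plane) : ℝ :=
  Metric.infDist z (whiten l P '' nullCone) ^ 2 - Metric.infDist z (whiten l P '' C) ^ 2

/-- The whitened direction of the `θ₁`-axis. -/
noncomputable def dirInterest : Plane := whiten l P (EuclideanSpace.single 0 1)

/-- The whitened direction of the `θ₂`-axis; it spans the whitened null cone. -/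
noncomputable def dirNuisance : Plane := whiten l P (EuclideanSpace.single 1 1)

/-- The part of the whitened quadrant that projects to the origin of the null ray. -/
def region1 : Set Plane :=
  whiten l P '' altCone ∩ {z | inner ℝ z (dirNuisance l P) ≤ 0}

/-- The part of the whitened quadrant that is adjacent to the null ray. -/
def region2 : Set Plane :=
  whiten l P '' altCone ∩ {z | 0 ≤ inner ℝ z (dirNuisance l P)}

/-- Between the null ray and the negative whitened `θ₁`-axis. -/
def region3 : Set Plane := whiten l P '' {θ | θ 0 ≤ 0 ∧ 0 ≤ θ 1}

/-- Beyond the negative whitened `θ₁`-axis, still projecting to the interior of the null ray. -/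
def region4 : Set Plane :=
  whiten l P '' {θ | θ 1 ≤ 0} ∩
    {z | inner ℝ z (dirInterest l P) ≤ 0 ∧ 0 ≤ inner ℝ z (dirNuisance l P)}

/-- The polar cone of the whitened quadrant. -/
def region5 : Set Plane :=
  {z | inner ℝ z (dirInterest l P) ≤ 0 ∧ inner ℝ z (dirNuisance l P) ≤ 0}

/-- The right angle between the polar cone and the positive whitened `θ₁`-axis. -/
def region6 : Set Plane :=
  whiten l P '' {θ | θ 1 ≤ 0} ∩ {z | 0 ≤ inner ℝ z (dirInterest l P)}

end Whitened

end BoundaryLRT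

/-! Since `WᵀW = I`, whitening turns `Q` into squared Euclidean distance, makes `Z` standard
Gaussian, and gives `u, v` the Gram matrix `I`. Inverting a 2×2 matrix flips the sign of its
off-diagonal entry, so the angle between `u` and `v` has cosine `-ρ`. This yields an orthonormal
frame `f, n` with `f` along `v` and `u` at angle `π/2 + γ` from it (`exists_adaptedFrame`). For a
point `z` write `x = ⟨z, f⟩`, `y = ⟨z, n⟩`, and in the frame rotated by `γ`, `w = cos γ · x + sin γ
· y`, `p = cos γ · y - sin γ · x`: `p` is the coordinate along `u`, `w` the one along the normal of
`u` pointing into `WH`.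

The six sectors are sign conditions on `x, y, w, p`. Explicit nearest points show that the quadrant
statistic is `‖z‖²` on `R₁`, `y²` on `R₂`, `p²` on `R₆` and `0` elsewhere. Rotation invariance gives
each law: a sector of angle `γ` contributes `γ/(2π) χ²₂` to the squared radius
(`stdNormal_prod_sector`), a right angle contributes `χ²₁/4` to the square of a coordinate along one
of its sides (`stdGaussian_quadrant`), and the other sectors carry the remaining mass. Overlaps lie
on four lines, which are null.

For the half-plane, `T_H = y² + min(x,0)² - min(w,0)²`. It vanishes only on a null set, and its mean
is `1 + 1/2 - 1/2 = 1`. A mixture equal to its law would therefore be `χ²₁`. But `R₁` contributes `q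
χ²₂` with `q > 0`, and `χ²₁` cannot dominate this: exponential moments at parameters tending to
`1/2` grow strictly faster for `χ²₂` (`not_smul_chiSq_two_le_smul_chiSq_one`). -/

namespace BoundaryLRT

/-! ### Chi-square laws and their moments -/

section OneDimensional

lemma chiSq_zero : chiSq 0 = Measure.dirac 0 := by
  simp [chiSq, Measure.map_const]

lemma chiSq_one : chiSq 1 = (gaussianReal 0 1).map fun x => x ^ 2 := by
  have h := (measurePreserving_funUnique (gaussianReal 0 1) (Fin 1)).map_eq
  conv_rhs => rw [← h]
  rw [chiSq, Measure.map_map (by fun_prop) (by fun_prop)]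
  congr 1
  ext x
  simp

lemma chiSq_two : chiSq 2 =
    ((gaussianReal 0 1).prod (gaussianReal 0 1)).map fun p => p.1 ^ 2 + p.2 ^ 2 := by
  have h := (measurePreserving_finTwoArrow (gaussianReal 0 1)).map_eq
  rw [chiSq, ← h, Measure.map_map (by fun_prop) (by fun_prop)]
  congr 1
  ext x
  simp

instance isProbabilityMeasure_chiSq (k : ℕ) : IsProbabilityMeasure (chiSq k) :=
  Measure.isProbabilityMeasure_map (Measurable.aemeasurable (by fun_prop))

instance nullSingletonClass_stdNormal : NullSingletonClass (gaussianReal 0 1) :=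
  nullSingletonClass_gaussianReal one_ne_zero

lemma stdNormal_map_neg : (gaussianReal 0 1).map (fun x => -x) = gaussianReal 0 1 := by
  simpa using gaussianReal_map_neg (μ := 0) (v := 1)

/-- A standard normal variable restricted to the half line contributes half of its law to even
functions. -/
lemma stdNormal_restrict_map_sq :
    ((gaussianReal 0 1).restrict (Set.Ici 0)).map (fun x => x ^ 2) =
      ENNReal.ofReal (1 / 2) • chiSq 1 := by
  have hneg : ((gaussianReal 0 1).restrict (Set.Iic 0)).map (fun x => x ^ 2) =
      ((gaussianReal 0 1).restrict (Set.Ici 0)).map (fun x => x ^ 2) := by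
    have h : (gaussianReal 0 1).restrict (Set.Ici 0) =
        ((gaussianReal 0 1).restrict (Set.Iic 0)).map (fun x => -x) := by
      conv_lhs => rw [← stdNormal_map_neg]
      rw [Measure.restrict_map (by fun_prop) measurableSet_Ici]
      congr 2
      ext x
      simp
    rw [h, Measure.map_map (by fun_prop) (by fun_prop)]
    congr 1
    ext x
    simp
  have hsum : ((gaussianReal 0 1).restrict (Set.Iic 0)).map (fun x => x ^ 2) +
      ((gaussianReal 0 1).restrict (Set.Ici 0)).map (fun x => x ^ 2) = chiSq 1 := by
    rw [← Measure.map_add _ _ (by fun_prop), ← restrict_Ioi_eq_restrict_Ici, ← Set.compl_Iic,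
      Measure.restrict_add_restrict_compl measurableSet_Iic, chiSq_one]
  rw [← hsum, hneg, ← two_smul ENNReal, smul_smul]
  rw [show ENNReal.ofReal (1 / 2) * 2 = 1 by
    rw [show (2 : ENNReal) = ENNReal.ofReal 2 by simp, ← ENNReal.ofReal_mul (by norm_num)]
    norm_num, one_smul]

lemma stdNormal_Ici : gaussianReal 0 1 (Set.Ici 0) = ENNReal.ofReal (1 / 2) := by
  have h := congrArg (fun m => m Set.univ) stdNormal_restrict_map_sq
  simpa [Measure.map_apply (show Measurable fun x : ℝ => x ^ 2 by fun_prop)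
    MeasurableSet.univ] using h

lemma lintegral_sq_stdNormal : ∫⁻ x, ENNReal.ofReal (x ^ 2) ∂(gaussianReal 0 1) = 1 := by
  have h := variance_fun_id_gaussianReal (μ := 0) (v := 1)
  have hm : MemLp (fun x : ℝ => x) 2 (gaussianReal 0 1) := memLp_id_gaussianReal' 2 (by simp)
  rw [variance_eq_integral (by fun_prop)] at h
  rw [← ofReal_integral_eq_lintegral_ofReal hm.integrable_sq (ae_of_all _ fun x => sq_nonneg x)]
  simp at h
  simp [h]

/-- By symmetry the negative part carries half of the second moment. Both truncated terms of the
half-plane statistic have this mean. -/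
lemma lintegral_min_sq_stdNormal :
    ∫⁻ x, ENNReal.ofReal (min x 0 ^ 2) ∂(gaussianReal 0 1) = ENNReal.ofReal (1 / 2) := by
  have h1 : ∫⁻ x, ENNReal.ofReal (min x 0 ^ 2) ∂(gaussianReal 0 1) =
      ∫⁻ x in Set.Ici 0, ENNReal.ofReal (x ^ 2) ∂(gaussianReal 0 1) := by
    conv_lhs => rw [← stdNormal_map_neg]
    rw [lintegral_map (by fun_prop) (by fun_prop), ← lintegral_indicator measurableSet_Ici]
    congr 1
    ext x
    by_cases hx : 0 ≤ x
    · simp [hx]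
    · simp [hx, le_of_not_ge hx]
  have h2 := lintegral_map (μ := (gaussianReal 0 1).restrict (Set.Ici 0))
    (f := ENNReal.ofReal) (g := fun x => x ^ 2) (by fun_prop) (by fun_prop)
  rw [h1, ← h2, stdNormal_restrict_map_sq, lintegral_smul_measure, chiSq_one,
    lintegral_map (by fun_prop) (by fun_prop), lintegral_sq_stdNormal]
  simp

/-- Together with the total mass, the differing means of `χ²₁` and `χ²₂` determine the weights of a
mixture that has no `χ²₀` part. -/
lemma lintegral_ofReal_chiSq_one : ∫⁻ t, ENNReal.ofReal t ∂(chiSq 1) = 1 := by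
  rw [chiSq_one, lintegral_map (by fun_prop) (by fun_prop), lintegral_sq_stdNormal]

lemma lintegral_ofReal_chiSq_two : ∫⁻ t, ENNReal.ofReal t ∂(chiSq 2) = 2 := by
  rw [chiSq_two, lintegral_map (by fun_prop) (by fun_prop)]
  simp_rw [fun p : ℝ × ℝ => ENNReal.ofReal_add (sq_nonneg p.1) (sq_nonneg p.2)]
  rw [lintegral_add_left (by fun_prop),
    lintegral_prod (fun p : ℝ × ℝ => ENNReal.ofReal (p.1 ^ 2)) (by fun_prop),
    lintegral_prod (fun p : ℝ × ℝ => ENNReal.ofReal (p.2 ^ 2)) (by fun_prop)]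
  simp [lintegral_sq_stdNormal, one_add_one_eq_two]

/-- The exponential moment of `χ²₁` at `(1 - δ²) / 2`. -/
lemma lintegral_exp_chiSq_one {δ : ℝ} (hδ : 0 < δ) :
    ∫⁻ t, ENNReal.ofReal (Real.exp ((1 - δ ^ 2) / 2 * t)) ∂(chiSq 1) = ENNReal.ofReal δ⁻¹ := by
  rw [chiSq_one, lintegral_map (by fun_prop) (by fun_prop),
    gaussianReal_of_var_ne_zero _ one_ne_zero,
    lintegral_withDensity_eq_lintegral_mul _ (by fun_prop) (by fun_prop)]
  have h : ∀ x : ℝ, (gaussianPDF 0 1 * fun x : ℝ =>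
      ENNReal.ofReal (Real.exp ((1 - δ ^ 2) / 2 * x ^ 2))) x =
      ENNReal.ofReal ((√(2 * Real.pi))⁻¹ * Real.exp (-(δ ^ 2 / 2) * x ^ 2)) := by
    intro x
    rw [Pi.mul_apply, gaussianPDF, ← ENNReal.ofReal_mul (gaussianPDFReal_nonneg _ _ _),
      gaussianPDFReal]
    simp only [NNReal.coe_one, mul_one, sub_zero]
    rw [mul_assoc, ← Real.exp_add]
    ring_nf
  have hi : Integrable fun x : ℝ => (√(2 * Real.pi))⁻¹ * Real.exp (-(δ ^ 2 / 2) * x ^ 2) :=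
    (integrable_exp_neg_mul_sq (by positivity)).const_mul _
  simp_rw [h]
  rw [← ofReal_integral_eq_lintegral_ofReal hi (ae_of_all _ fun x => by positivity),
    integral_const_mul, integral_gaussian]
  congr 1
  rw [show Real.pi / (δ ^ 2 / 2) = 2 * Real.pi / δ ^ 2 by field_simp,
    Real.sqrt_div (by positivity), Real.sqrt_sq hδ.le]
  field_simp

/-- Independence squares the one-dimensional moment, so as `δ → 0` it grows like `δ⁻²` instead of
`δ⁻¹`. -/
lemma lintegral_exp_chiSq_two {δ : ℝ} (hδ : 0 < δ) :
    ∫⁻ t, ENNReal.ofReal (Real.exp ((1 - δ ^ 2) / 2 * t)) ∂(chiSq 2) =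
      ENNReal.ofReal δ⁻¹ * ENNReal.ofReal δ⁻¹ := by
  have h1 := lintegral_exp_chiSq_one hδ
  rw [chiSq_one, lintegral_map (by fun_prop) (by fun_prop)] at h1
  rw [chiSq_two, lintegral_map (by fun_prop) (by fun_prop)]
  simp_rw [mul_add, Real.exp_add, ENNReal.ofReal_mul (Real.exp_nonneg _)]
  rw [lintegral_prod_mul (f := fun x : ℝ => ENNReal.ofReal (Real.exp ((1 - δ ^ 2) / 2 * x ^ 2)))
    (g := fun x : ℝ => ENNReal.ofReal (Real.exp ((1 - δ ^ 2) / 2 * x ^ 2)))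
    (by fun_prop) (by fun_prop), h1]

/-- No positive multiple of `χ²₂` is dominated by a finite multiple of `χ²₁`. -/
lemma not_smul_chiSq_two_le_smul_chiSq_one {c w : ℝ} (hc : 0 < c) :
    ¬ ENNReal.ofReal c • chiSq 2 ≤ ENNReal.ofReal w • chiSq 1 := by
  intro h
  have key : ∀ δ : ℝ, 0 < δ → c * δ⁻¹ ≤ max w 0 := by
    intro δ hδ
    have h1 := lintegral_mono' h
      (le_refl fun t => ENNReal.ofReal (Real.exp ((1 - δ ^ 2) / 2 * t)))
    rw [lintegral_smul_measure, lintegral_smul_measure, lintegral_exp_chiSq_one hδ,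
      lintegral_exp_chiSq_two hδ, smul_eq_mul, smul_eq_mul, ← mul_assoc] at h1
    have h2 : ENNReal.ofReal c * ENNReal.ofReal δ⁻¹ ≤ ENNReal.ofReal w :=
      (ENNReal.mul_le_mul_iff_left (by simpa using hδ) ENNReal.ofReal_ne_top).1 h1
    rw [← ENNReal.ofReal_mul hc.le] at h2
    rwa [← ENNReal.ofReal_le_ofReal_iff (le_max_right _ _), ENNReal.ofReal_max,
      ENNReal.ofReal_zero, max_eq_left zero_le]
  have hM : 0 ≤ max w 0 := le_max_right _ _
  -- This `δ` makes the left side of `key` equal to `max w 0 + 1`.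
  have := key (c / (max w 0 + 1)) (by positivity)
  rw [inv_div, mul_div_cancel₀ _ hc.ne'] at this
  linarith

end OneDimensional

/-! ### Standard Gaussian laws in the plane -/

section Planar

lemma measurableSet_nonneg_and_nonneg_and_nonneg {α : Type*} [MeasurableSpace α] {f g h : α → ℝ}
    (hf : Measurable f) (hg : Measurable g) (hh : Measurable h) :
    MeasurableSet {x | 0 ≤ f x ∧ 0 ≤ g x ∧ 0 ≤ h x} := by
  rw [Set.ofPred_and, Set.ofPred_and]
  exact (measurableSet_le measurable_const hf).inter
    ((measurableSet_le measurable_const hg).inter (measurableSet_le measurable_const hh))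

/-- The orthonormal basis formed by an orthonormal pair in the plane. -/
noncomputable def pairBasis {e f : Plane} (h : Orthonormal ℝ ![e, f]) :
    OrthonormalBasis (Fin 2) ℝ Plane :=
  (basisOfOrthonormalOfCardEqFinrank h (by simp)).toOrthonormalBasis (by simpa using h)

lemma coe_pairBasis {e f : Plane} (h : Orthonormal ℝ ![e, f]) : ⇑(pairBasis h) = ![e, f] := by
  simp [pairBasis]

lemma orthonormal_pair_iff {e f : Plane} :
    Orthonormal ℝ ![e, f] ↔ ‖e‖ = 1 ∧ ‖f‖ = 1 ∧ inner ℝ e f = 0 := by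
  rw [orthonormal_iff_ite]
  simp only [Fin.forall_fin_two, Matrix.cons_val_zero, Matrix.cons_val_one]
  simp only [real_inner_self_eq_norm_sq, real_inner_comm e f]
  have h1 : ∀ g : Plane, ‖g‖ ^ 2 = 1 ↔ ‖g‖ = 1 := fun g =>
    pow_eq_one_iff_of_nonneg (norm_nonneg g) two_ne_zero
  simp [h1]
  tauto

lemma eq_add_of_orthonormal {e f : Plane} (h : Orthonormal ℝ ![e, f]) (z : Plane) :
    z = inner ℝ z e • e + inner ℝ z f • f := by
  have := (pairBasis h).sum_repr' z
  simp only [coe_pairBasis, Fin.sum_univ_two] at this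
  simp only [Matrix.cons_val_zero, Matrix.cons_val_one] at this
  rw [real_inner_comm e z, real_inner_comm f z]
  exact this.symm

lemma norm_sq_of_orthonormal {e f : Plane} (h : Orthonormal ℝ ![e, f]) (z : Plane) :
    ‖z‖ ^ 2 = inner ℝ z e ^ 2 + inner ℝ z f ^ 2 := by
  rw [← (pairBasis h).sum_sq_inner_left z]
  simp [coe_pairBasis, Fin.sum_univ_two]

/-- The coordinates of a standard Gaussian vector in an orthonormal frame are independent standard
normal variables. -/
lemma stdGaussian_map_pair {e f : Plane} (h : Orthonormal ℝ ![e, f]) :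
    (stdGaussian Plane).map (fun z => (inner ℝ z e, inner ℝ z f)) =
      (gaussianReal 0 1).prod (gaussianReal 0 1) := by
  rw [stdGaussian_eq_map_pi_orthonormalBasis (pairBasis h),
    Measure.map_map (by fun_prop) (by fun_prop),
    ← (measurePreserving_finTwoArrow (gaussianReal 0 1)).map_eq]
  congr 1
  ext x
  all_goals
    obtain ⟨h1, h2, h3⟩ := orthonormal_pair_iff.1 h
    simp [coe_pairBasis, Fin.sum_univ_two, inner_add_left, inner_smul_left, h1, h2, h3,
      real_inner_comm e f]

lemma stdGaussian_map_inner (w : Plane) :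
    (stdGaussian Plane).map (fun z => inner ℝ z w) = gaussianReal 0 (‖w‖₊ ^ 2) := by
  have h := IsGaussian.map_eq_gaussianReal (μ := stdGaussian Plane) (innerSL ℝ w)
  rw [integral_strongDual_stdGaussian, variance_dual_stdGaussian, innerSL_apply_norm] at h
  have h2 : ⇑(innerSL ℝ w) = fun z => inner ℝ z w := by
    ext z
    simp [real_inner_comm]
  rw [← h2, h]
  congr 1
  ext
  simp

lemma stdGaussian_map_inner_of_norm_eq_one {w : Plane} (hw : ‖w‖ = 1) :
    (stdGaussian Plane).map (fun z => inner ℝ z w) = gaussianReal 0 1 := by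
  rw [stdGaussian_map_inner]
  congr 1
  ext
  simp [hw]

lemma stdGaussian_line {w : Plane} (hw : w ≠ 0) :
    stdGaussian Plane {z | inner ℝ z w = 0} = 0 := by
  have h := congrArg (fun m => m {0}) (stdGaussian_map_inner w)
  have : NullSingletonClass (gaussianReal 0 (‖w‖₊ ^ 2)) :=
    nullSingletonClass_gaussianReal (by simpa using hw)
  simp only [measure_singleton] at h
  rwa [Measure.map_apply (by fun_prop) (measurableSet_singleton _)] at h

/-- A quadrant contributes `χ²₁ / 4` to the law of a squared coordinate. -/
lemma stdGaussian_quadrant {e f : Plane} (h : Orthonormal ℝ ![e, f]) :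
    ((stdGaussian Plane).restrict {z | 0 ≤ inner ℝ z e ∧ 0 ≤ inner ℝ z f}).map
        (fun z => inner ℝ z f ^ 2) = ENNReal.ofReal (1 / 4) • chiSq 1 := by
  have hs : {z : Plane | 0 ≤ inner ℝ z e ∧ 0 ≤ inner ℝ z f} =
      (fun z => (inner ℝ z e, inner ℝ z f)) ⁻¹' (Set.Ici (0 : ℝ) ×ˢ Set.Ici (0 : ℝ)) := by
    ext z
    simp
  have hf : (fun z : Plane => inner ℝ z f ^ 2) =
      (fun x : ℝ => x ^ 2) ∘ Prod.snd ∘ fun z => (inner ℝ z e, inner ℝ z f) := rfl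
  rw [hf, ← Measure.map_map (by fun_prop) (by fun_prop),
    ← Measure.map_map (by fun_prop) (by fun_prop), hs,
    ← Measure.restrict_map (by fun_prop) (measurableSet_Ici.prod measurableSet_Ici),
    stdGaussian_map_pair h, ← Measure.prod_restrict, Measure.map_snd_prod, Measure.map_smul,
    Measure.restrict_apply_univ, stdNormal_restrict_map_sq, stdNormal_Ici, smul_smul,
    ← ENNReal.ofReal_mul (by norm_num)]
  norm_num

/-- The density depends on the radius only, which separates radius and angle in polar coordinates.
-/
lemma stdNormal_prod_eq_withDensity : (gaussianReal 0 1).prod (gaussianReal 0 1) =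
    (volume : Measure (ℝ × ℝ)).withDensity fun p =>
      ENNReal.ofReal ((2 * Real.pi)⁻¹ * Real.exp (-(p.1 ^ 2 + p.2 ^ 2) / 2)) := by
  rw [gaussianReal_of_var_ne_zero _ one_ne_zero, prod_withDensity (by fun_prop) (by fun_prop)]
  congr 1
  ext p
  rw [gaussianPDF, gaussianPDF, ← ENNReal.ofReal_mul (gaussianPDFReal_nonneg _ _ _)]
  congr 1
  simp only [gaussianPDFReal, NNReal.coe_one, mul_one, sub_zero]
  rw [mul_mul_mul_comm, ← Real.exp_add, ← mul_inv, Real.mul_self_sqrt (by positivity)]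
  ring_nf

/-- The third expression is `sin (γ - φ)`, so the signs of two sines confine the angle. -/
lemma sector_iff {γ φ : ℝ} (h0 : 0 ≤ γ) (h1 : γ < Real.pi / 2)
    (hφ : φ ∈ Set.Ioo (-Real.pi) Real.pi) :
    (0 ≤ Real.cos φ ∧ 0 ≤ Real.sin φ ∧ 0 ≤ Real.sin γ * Real.cos φ - Real.cos γ * Real.sin φ) ↔
      φ ∈ Set.Icc 0 γ := by
  have hπ := Real.pi_pos
  rw [← Real.sin_sub]
  constructor
  · rintro ⟨-, h2, h3⟩
    have h4 : 0 ≤ φ := by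
      by_contra! h
      exact absurd h2 (not_le.2 (Real.sin_neg_of_neg_of_neg_pi_lt h hφ.1))
    refine ⟨h4, ?_⟩
    by_contra! h
    exact absurd h3 (not_le.2 (Real.sin_neg_of_neg_of_neg_pi_lt (by linarith) (by linarith [hφ.2])))
  · rintro ⟨h2, h3⟩
    exact ⟨Real.cos_nonneg_of_neg_pi_div_two_le_of_le (by linarith) (by linarith),
      Real.sin_nonneg_of_nonneg_of_le_pi h2 (by linarith),
      Real.sin_nonneg_of_nonneg_of_le_pi (by linarith) (by linarith)⟩

/-- The sector of angles `[0, γ]` contributes `γ / (2π) χ²₂` to the law of the squared radius. -/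
lemma stdNormal_prod_sector {γ : ℝ} (h0 : 0 ≤ γ) (h1 : γ < Real.pi / 2) :
    (((gaussianReal 0 1).prod (gaussianReal 0 1)).restrict
      {p | 0 ≤ p.1 ∧ 0 ≤ p.2 ∧ 0 ≤ Real.sin γ * p.1 - Real.cos γ * p.2}).map
        (fun p => p.1 ^ 2 + p.2 ^ 2) = ENNReal.ofReal (γ / (2 * Real.pi)) • chiSq 2 := by
  have hπ := Real.pi_pos
  set S : Set (ℝ × ℝ) := {p | 0 ≤ p.1 ∧ 0 ≤ p.2 ∧ 0 ≤ Real.sin γ * p.1 - Real.cos γ * p.2}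
  have hS : MeasurableSet S :=
    measurableSet_nonneg_and_nonneg_and_nonneg (by fun_prop) (by fun_prop) (by fun_prop)
  -- Integrals of radial functions over an angular sector.
  have polar : ∀ (A : Set (ℝ × ℝ)) (B : Set ℝ), MeasurableSet A → MeasurableSet B →
      B ⊆ Set.Icc (-Real.pi) Real.pi →
      (∀ r φ : ℝ, 0 < r → φ ∈ Set.Ioo (-Real.pi) Real.pi →
        ((r * Real.cos φ, r * Real.sin φ) ∈ A ↔ φ ∈ B)) →
      ∀ g : ℝ → ENNReal, Measurable g →
      ∫⁻ p in A, g (p.1 ^ 2 + p.2 ^ 2) ∂((gaussianReal 0 1).prod (gaussianReal 0 1)) =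
        volume B * ∫⁻ r in Set.Ioi (0 : ℝ), ENNReal.ofReal r *
          (ENNReal.ofReal ((2 * Real.pi)⁻¹ * Real.exp (-(r ^ 2) / 2)) * g (r ^ 2)) := by
    intro A B hA hB hBs hAB g hg
    rw [stdNormal_prod_eq_withDensity, restrict_withDensity hA,
      lintegral_withDensity_eq_lintegral_mul _ (by fun_prop) (by fun_prop),
      ← lintegral_indicator hA, ← lintegral_comp_polarCoord_symm]
    have hcongr : ∀ p ∈ polarCoord.target, ENNReal.ofReal p.1 • A.indicator
        ((fun p : ℝ × ℝ => ENNReal.ofReal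
          ((2 * Real.pi)⁻¹ * Real.exp (-(p.1 ^ 2 + p.2 ^ 2) / 2))) *
            fun p => g (p.1 ^ 2 + p.2 ^ 2)) (polarCoord.symm p) =
        (ENNReal.ofReal p.1 * (ENNReal.ofReal
          ((2 * Real.pi)⁻¹ * Real.exp (-(p.1 ^ 2) / 2)) * g (p.1 ^ 2))) *
            B.indicator 1 p.2 := by
      rintro ⟨r, φ⟩ ⟨hr, hφ⟩
      have hsq : (r * Real.cos φ) ^ 2 + (r * Real.sin φ) ^ 2 = r ^ 2 := by
        rw [mul_pow, mul_pow, ← mul_add, Real.cos_sq_add_sin_sq, mul_one]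
      have hmem := hAB r φ hr hφ
      by_cases hb : φ ∈ B
      · simp only [polarCoord_symm_apply, Set.indicator_of_mem (hmem.2 hb), Pi.mul_apply, hsq,
          Set.indicator_of_mem hb, Pi.one_apply, mul_one, smul_eq_mul]
      · simp [hb, mt hmem.1 hb]
    rw [setLIntegral_congr_fun polarCoord.open_target.measurableSet hcongr, polarCoord_target,
      Measure.volume_eq_prod, ← Measure.prod_restrict,
      lintegral_prod_mul (f := fun r : ℝ => ENNReal.ofReal r * (ENNReal.ofReal
          ((2 * Real.pi)⁻¹ * Real.exp (-(r ^ 2) / 2)) * g (r ^ 2))) (by fun_prop)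
        ((measurable_one.indicator hB).aemeasurable), mul_comm]
    congr 1
    -- Polar angles range over an open interval while `B` may contain `±π`; the endpoints are null.
    rw [lintegral_indicator_one hB, Measure.restrict_congr_set Ioo_ae_eq_Icc,
      Measure.restrict_apply hB, Set.inter_eq_left.2 hBs]
  refine Measure.ext_of_lintegral _ fun g hg => ?_
  rw [lintegral_map hg (by fun_prop), lintegral_smul_measure, chiSq_two,
    lintegral_map hg (by fun_prop)]
  rw [polar S (Set.Icc 0 γ) hS measurableSet_Icc (Set.Icc_subset_Icc (by linarith) (by linarith))
    _ g hg]
  -- The full plane has the same radial integral with angular length `2π`, so the weight is the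
  -- ratio of the angular lengths.
  · rw [← setLIntegral_univ (μ := (gaussianReal 0 1).prod (gaussianReal 0 1)),
      polar Set.univ (Set.Icc (-Real.pi) Real.pi) MeasurableSet.univ measurableSet_Icc subset_rfl (fun r φ hr hφ => by simpa using ⟨hφ.1.le, hφ.2.le⟩) g hg,
      smul_eq_mul, ← mul_assoc, Real.volume_Icc, Real.volume_Icc,
      ← ENNReal.ofReal_mul (by positivity)]
    congr 2
    field_simp
    ring
  · intro r φ hr hφ
    rw [← sector_iff h0 h1 hφ]
    have h2 : Real.sin γ * (r * Real.cos φ) - Real.cos γ * (r * Real.sin φ) =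
      r * (Real.sin γ * Real.cos φ - Real.cos γ * Real.sin φ) := by ring
    simp only [S, Set.mem_ofPred_eq, h2, mul_nonneg_iff_of_pos_left hr]

lemma stdGaussian_sector {e f : Plane} (h : Orthonormal ℝ ![e, f]) {γ : ℝ} (h0 : 0 ≤ γ)
    (h1 : γ < Real.pi / 2) :
    ((stdGaussian Plane).restrict {z | 0 ≤ inner ℝ z e ∧ 0 ≤ inner ℝ z f ∧
      0 ≤ Real.sin γ * inner ℝ z e - Real.cos γ * inner ℝ z f}).map (fun z => ‖z‖ ^ 2) =
        ENNReal.ofReal (γ / (2 * Real.pi)) • chiSq 2 := by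
  rw [← stdNormal_prod_sector h0 h1, ← stdGaussian_map_pair h, Measure.restrict_map (by fun_prop),
    Measure.map_map (by fun_prop) (by fun_prop)]
  · congr 1
    ext z
    exact norm_sq_of_orthonormal h z
  · exact measurableSet_nonneg_and_nonneg_and_nonneg (by fun_prop) (by fun_prop) (by fun_prop)

lemma lintegral_inner_sq_stdGaussian {w : Plane} (hw : ‖w‖ = 1) :
    ∫⁻ z, ENNReal.ofReal (inner ℝ z w ^ 2) ∂(stdGaussian Plane) = 1 := by
  rw [← lintegral_sq_stdNormal, ← stdGaussian_map_inner_of_norm_eq_one hw,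
    lintegral_map (by fun_prop) (by fun_prop)]

lemma lintegral_min_inner_sq_stdGaussian {w : Plane} (hw : ‖w‖ = 1) :
    ∫⁻ z, ENNReal.ofReal (min (inner ℝ z w) 0 ^ 2) ∂(stdGaussian Plane) =
      ENNReal.ofReal (1 / 2) := by
  rw [← lintegral_min_sq_stdNormal, ← stdGaussian_map_inner_of_norm_eq_one hw,
    lintegral_map (by fun_prop) (by fun_prop)]

/-- If `L ᵀ L = S`, then `L` whitens the centred Gaussian law with covariance `S⁻¹`. -/
lemma multivariateGaussian_map_toEuclideanLin {S L : Matrix (Fin 2) (Fin 2) ℝ} (hS : S.PosDef)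
    (hL : Lᵀ * L = S) :
    (multivariateGaussian 0 S⁻¹).map (Matrix.toEuclideanLin L) = stdGaussian Plane := by
  have hmeas : Measurable (Matrix.toEuclideanLin L : Plane → Plane) :=
    (LinearMap.continuous_of_finiteDimensional _).measurable
  have hdet : IsUnit L.det := by
    have := congrArg Matrix.det hL
    rw [Matrix.det_mul] at this
    have h2 := hS.det_pos
    rw [isUnit_iff_ne_zero]
    rintro h
    rw [h, mul_zero] at this
    linarith
  -- This is the covariance of the image; the characteristic functions then agree.
  have hinv : L * S⁻¹ * Lᵀ = 1 := by
    rw [← hL, Matrix.mul_inv_rev, ← mul_assoc, Matrix.mul_nonsing_inv _ hdet, one_mul,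
      Matrix.nonsing_inv_mul _ (by rwa [Matrix.det_transpose])]
  have : IsProbabilityMeasure ((multivariateGaussian (0 : Plane) S⁻¹).map
      (Matrix.toEuclideanLin L)) := Measure.isProbabilityMeasure_map hmeas.aemeasurable
  refine Measure.ext_of_charFun (E := Plane) ?_
  ext t
  have hadj : ∀ x : Plane, inner ℝ (Matrix.toEuclideanLin L x) t =
      inner ℝ x (Matrix.toEuclideanLin Lᵀ t) := by
    intro x
    simp only [EuclideanSpace.inner_eq_star_dotProduct, Matrix.toLpLin_apply, star_trivial]
    rw [Matrix.dotProduct_mulVec, Matrix.mulVec_transpose]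
  have h1 : charFun ((multivariateGaussian (0 : Plane) S⁻¹).map (Matrix.toEuclideanLin L)) t =
      charFun (multivariateGaussian (0 : Plane) S⁻¹) (Matrix.toEuclideanLin Lᵀ t) := by
    rw [charFun_apply, charFun_apply, integral_map hmeas.aemeasurable
      (Measurable.aestronglyMeasurable (by fun_prop))]
    simp_rw [hadj]
  have h2 : (Lᵀ *ᵥ t.ofLp) ⬝ᵥ S⁻¹ *ᵥ (Lᵀ *ᵥ t.ofLp) = ‖t‖ ^ 2 := by
    rw [Matrix.mulVec_mulVec, Matrix.mulVec_transpose, ← Matrix.dotProduct_mulVec,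
      Matrix.mulVec_mulVec, ← mul_assoc, hinv, Matrix.one_mulVec, EuclideanSpace.real_norm_sq_eq]
    simp [dotProduct, Fin.sum_univ_two, sq]
  rw [h1, charFun_multivariateGaussian hS.inv.posSemidef, charFun_stdGaussian]
  have h3 : (Matrix.toEuclideanLin Lᵀ t).ofLp = Lᵀ *ᵥ t.ofLp := rfl
  rw [h3, h2]
  simp [neg_div]

end Planar

/-! ### Adapted frames and nearest points -/

section Geometry

/-- Certifies an explicit candidate `k` as a nearest point; all cone distances below are computed in
this way. -/
lemma infDist_sq_eq_of_forall_le {K : Set Plane} {z k : Plane} {d : ℝ} (hk : k ∈ K)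
    (hd : ‖z - k‖ ^ 2 = d) (h : ∀ k' ∈ K, d ≤ ‖z - k'‖ ^ 2) : Metric.infDist z K ^ 2 = d := by
  have h1 : Metric.infDist z K = ‖z - k‖ := by
    refine le_antisymm ((Metric.infDist_le_dist_of_mem hk).trans_eq (dist_eq_norm _ _)) ?_
    refine (Metric.le_infDist ⟨k, hk⟩).2 fun k' hk' => ?_
    rw [dist_eq_norm]
    exact (sq_le_sq₀ (norm_nonneg _) (norm_nonneg _)).1 (hd.trans_le (h k' hk'))
  rw [h1, hd]

/-- Squaring is monotone on nonnegative reals and so commutes with the infimum. This links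
`quadStat` to `distStat`. -/
lemma iInf_dist_sq_eq_infDist_sq (L : Plane → Plane) {K : Set Plane} (hK : K.Nonempty)
    (z : Plane) : ⨅ θ : K, dist z (L θ) ^ 2 = Metric.infDist z (L '' K) ^ 2 := by
  have : Nonempty K := hK.to_subtype
  have hb : BddBelow (Set.range fun θ : K => dist z (L θ) ^ 2) :=
    ⟨0, by rintro _ ⟨θ, rfl⟩; positivity⟩
  refine le_antisymm ?_ (le_ciInf fun θ => ?_)
  · have h0 : 0 ≤ ⨅ θ : K, dist z (L θ) ^ 2 := le_ciInf fun θ => by positivity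
    rw [← Real.sqrt_le_left Metric.infDist_nonneg, Metric.le_infDist (hK.image L)]
    rintro _ ⟨θ, hθ, rfl⟩
    rw [Real.sqrt_le_left dist_nonneg]
    exact ciInf_le hb ⟨θ, hθ⟩
  · exact pow_le_pow_left₀ Metric.infDist_nonneg
      (Metric.infDist_le_dist_of_mem (Set.mem_image_of_mem L θ.2)) 2

/-- An orthonormal frame `f, n` whose first vector spans the null ray, and in which the direction
of interest has angle `π / 2 + γ`. -/
structure AdaptedFrame (l : Fin 2 → ℝ) (P : Matrix (Fin 2) (Fin 2) ℝ) (f n : Plane)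
    (a b γ : ℝ) : Prop where
  orthonormal : Orthonormal ℝ ![f, n]
  pos_interest : 0 < a
  pos_nuisance : 0 < b
  angle_nonneg : 0 ≤ γ
  angle_lt : γ < Real.pi / 2
  interest_eq : dirInterest l P = a • (Real.cos γ • n - Real.sin γ • f)
  nuisance_eq : dirNuisance l P = b • f

lemma whiten_apply (l : Fin 2 → ℝ) (P : Matrix (Fin 2) (Fin 2) ℝ) (θ : Plane) :
    whiten l P θ = θ 0 • dirInterest l P + θ 1 • dirNuisance l P := by
  rw [dirInterest, dirNuisance, ← map_smul, ← map_smul, ← map_add]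
  congr 1
  ext i
  fin_cases i <;> simp

namespace AdaptedFrame

variable {l : Fin 2 → ℝ} {P : Matrix (Fin 2) (Fin 2) ℝ} {f n : Plane} {a b γ : ℝ}

lemma cos_pos (h : AdaptedFrame l P f n a b γ) : 0 < Real.cos γ :=
  Real.cos_pos_of_mem_Ioo
    ⟨by linarith [h.angle_nonneg, Real.pi_pos], h.angle_lt⟩

lemma sin_nonneg (h : AdaptedFrame l P f n a b γ) : 0 ≤ Real.sin γ :=
  Real.sin_nonneg_of_nonneg_of_le_pi h.angle_nonneg (by linarith [h.angle_lt, Real.pi_pos])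

lemma inner_interest (h : AdaptedFrame l P f n a b γ) (z : Plane) :
    inner ℝ z (dirInterest l P) = a * (Real.cos γ * inner ℝ z n - Real.sin γ * inner ℝ z f) := by
  simp [h.interest_eq, inner_smul_right, inner_sub_right]

lemma inner_nuisance (h : AdaptedFrame l P f n a b γ) (z : Plane) :
    inner ℝ z (dirNuisance l P) = b * inner ℝ z f := by
  simp [h.nuisance_eq, inner_smul_right]

/-- The frame aligned with the direction of interest. -/
lemma orthonormal_rotated (h : AdaptedFrame l P f n a b γ) :
    Orthonormal ℝ ![Real.cos γ • f + Real.sin γ • n, Real.cos γ • n - Real.sin γ • f] := by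
  obtain ⟨h1, h2, h3⟩ := orthonormal_pair_iff.1 h.orthonormal
  have h4 := Real.cos_sq_add_sin_sq γ
  have h5 : inner ℝ n f = 0 := by rw [real_inner_comm, h3]
  refine orthonormal_pair_iff.2 ⟨?_, ?_, ?_⟩
  · rw [← pow_eq_one_iff_of_nonneg (norm_nonneg _) two_ne_zero, ← real_inner_self_eq_norm_sq]
    simp only [inner_add_left, inner_add_right, real_inner_smul_left, real_inner_smul_right,
      real_inner_self_eq_norm_sq, norm_smul, Real.norm_eq_abs, mul_pow, sq_abs, h1, h2, h3, h5]
    linarith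
  · rw [← pow_eq_one_iff_of_nonneg (norm_nonneg _) two_ne_zero, ← real_inner_self_eq_norm_sq]
    simp only [inner_sub_left, inner_sub_right, real_inner_smul_left, real_inner_smul_right,
      real_inner_self_eq_norm_sq, norm_smul, Real.norm_eq_abs, mul_pow, sq_abs, h1, h2, h3, h5]
    linarith
  · simp [inner_add_left, inner_sub_right, inner_smul_left, inner_smul_right, h1, h2, h3, h5]
    ring

lemma norm_interest (h : AdaptedFrame l P f n a b γ) : ‖dirInterest l P‖ = a := by
  rw [h.interest_eq, norm_smul, (orthonormal_pair_iff.1 h.orthonormal_rotated).2.1, mul_one,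
    Real.norm_of_nonneg h.pos_interest.le]

lemma norm_nuisance (h : AdaptedFrame l P f n a b γ) : ‖dirNuisance l P‖ = b := by
  rw [h.nuisance_eq, norm_smul, (orthonormal_pair_iff.1 h.orthonormal).1, mul_one,
    Real.norm_of_nonneg h.pos_nuisance.le]

/-- The functional `y` kills `v` and `w` kills `u`, so each recovers one original coordinate up to a
positive factor. -/
lemma inner_whiten (h : AdaptedFrame l P f n a b γ) (θ : Plane) :
    inner ℝ (whiten l P θ) n = a * Real.cos γ * θ 0 ∧
      Real.cos γ * inner ℝ (whiten l P θ) f + Real.sin γ * inner ℝ (whiten l P θ) n =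
        b * Real.cos γ * θ 1 := by
  obtain ⟨h1, h2, h3⟩ := orthonormal_pair_iff.1 h.orthonormal
  have h5 : inner ℝ n f = 0 := by rw [real_inner_comm, h3]
  rw [whiten_apply, h.interest_eq, h.nuisance_eq]
  simp [inner_add_left, inner_sub_left, inner_smul_left, h1, h2, h3, h5]
  constructor <;> ring

/-- Membership in the image of a set that is described by conditions on the coordinates. -/
lemma mem_image_whiten (h : AdaptedFrame l P f n a b γ) (p : ℝ → ℝ → Prop) (z : Plane) :
    z ∈ whiten l P '' {θ | p (θ 0) (θ 1)} ↔
      p (inner ℝ z n / (a * Real.cos γ))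
        ((Real.cos γ * inner ℝ z f + Real.sin γ * inner ℝ z n) / (b * Real.cos γ)) := by
  have hC := h.cos_pos
  have ha := h.pos_interest
  have hb := h.pos_nuisance
  constructor
  · rintro ⟨θ, hθ, rfl⟩
    rw [(h.inner_whiten θ).2, (h.inner_whiten θ).1, mul_div_cancel_left₀ _ (by positivity),
      mul_div_cancel_left₀ _ (by positivity)]
    exact hθ
  · intro hp
    refine ⟨!₂[inner ℝ z n / (a * Real.cos γ),
      (Real.cos γ * inner ℝ z f + Real.sin γ * inner ℝ z n) / (b * Real.cos γ)], by simpa using hp,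
      ?_⟩
    rw [whiten_apply, h.interest_eq, h.nuisance_eq]
    conv_rhs => rw [eq_add_of_orthonormal h.orthonormal z]
    simp only [Matrix.cons_val_zero, Matrix.cons_val_one]
    match_scalars <;> field_simp
    ring

lemma mem_image_nullCone (h : AdaptedFrame l P f n a b γ) (z : Plane) :
    z ∈ whiten l P '' nullCone ↔ inner ℝ z n = 0 ∧ 0 ≤ inner ℝ z f := by
  have hC := h.cos_pos
  have ha := h.pos_interest
  have hb := h.pos_nuisance
  rw [nullCone, h.mem_image_whiten (fun s t => s = 0 ∧ 0 ≤ t)]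
  rw [div_eq_zero_iff, or_iff_left (by positivity), le_div_iff₀ (by positivity), zero_mul]
  refine and_congr_right fun h0 => ?_
  rw [h0, mul_zero, add_zero, mul_nonneg_iff_of_pos_left hC]

lemma mem_image_altCone (h : AdaptedFrame l P f n a b γ) (z : Plane) :
    z ∈ whiten l P '' altCone ↔
      0 ≤ inner ℝ z n ∧ 0 ≤ Real.cos γ * inner ℝ z f + Real.sin γ * inner ℝ z n := by
  have hC := h.cos_pos
  have ha := h.pos_interest
  have hb := h.pos_nuisance
  rw [altCone, h.mem_image_whiten (fun s t => 0 ≤ s ∧ 0 ≤ t),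
    le_div_iff₀ (by positivity), zero_mul, le_div_iff₀ (by positivity), zero_mul]

lemma mem_image_halfPlane (h : AdaptedFrame l P f n a b γ) (z : Plane) :
    z ∈ whiten l P '' halfPlane ↔
      0 ≤ Real.cos γ * inner ℝ z f + Real.sin γ * inner ℝ z n := by
  have hC := h.cos_pos
  have hb := h.pos_nuisance
  rw [halfPlane, h.mem_image_whiten (fun s t => 0 ≤ t),
    le_div_iff₀ (by positivity), zero_mul]

lemma mem_image_lowerHalfPlane (h : AdaptedFrame l P f n a b γ) (z : Plane) :
    z ∈ whiten l P '' {θ | θ 1 ≤ 0} ↔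
      Real.cos γ * inner ℝ z f + Real.sin γ * inner ℝ z n ≤ 0 := by
  have hC := h.cos_pos
  have hb := h.pos_nuisance
  rw [h.mem_image_whiten (fun s t => t ≤ 0), div_le_iff₀ (by positivity), zero_mul]

/-! ### The six regions as sign conditions -/

lemma mem_region1 (h : AdaptedFrame l P f n a b γ) (z : Plane) :
    z ∈ region1 l P ↔ 0 ≤ inner ℝ z n ∧
      0 ≤ Real.cos γ * inner ℝ z f + Real.sin γ * inner ℝ z n ∧ inner ℝ z f ≤ 0 := by
  rw [region1, Set.mem_inter_iff, h.mem_image_altCone, Set.mem_ofPred_eq, h.inner_nuisance,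
    mul_nonpos_iff_pos_imp_nonpos, and_assoc]
  have := h.pos_nuisance
  constructor
  · rintro ⟨h1, h2, h3, h4⟩
    exact ⟨h1, h2, h3 this⟩
  · rintro ⟨h1, h2, h3⟩
    exact ⟨h1, h2, fun _ => h3, fun _ => this.le⟩

lemma mem_region2 (h : AdaptedFrame l P f n a b γ) (z : Plane) :
    z ∈ region2 l P ↔ 0 ≤ inner ℝ z f ∧ 0 ≤ inner ℝ z n := by
  rw [region2, Set.mem_inter_iff, h.mem_image_altCone, Set.mem_ofPred_eq, h.inner_nuisance,
    mul_nonneg_iff_of_pos_left h.pos_nuisance]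
  constructor
  · rintro ⟨⟨h1, -⟩, h3⟩
    exact ⟨h3, h1⟩
  · rintro ⟨h1, h2⟩
    exact ⟨⟨h2, add_nonneg (mul_nonneg h.cos_pos.le h1) (mul_nonneg h.sin_nonneg h2)⟩, h1⟩

lemma mem_region3 (h : AdaptedFrame l P f n a b γ) (z : Plane) :
    z ∈ region3 l P ↔ inner ℝ z n ≤ 0 ∧
      0 ≤ Real.cos γ * inner ℝ z f + Real.sin γ * inner ℝ z n := by
  have hC := h.cos_pos
  have ha := h.pos_interest
  have hb := h.pos_nuisance
  rw [region3, h.mem_image_whiten (fun s t => s ≤ 0 ∧ 0 ≤ t), div_le_iff₀ (by positivity),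
    zero_mul, le_div_iff₀ (by positivity), zero_mul]

lemma mem_region4 (h : AdaptedFrame l P f n a b γ) (z : Plane) :
    z ∈ region4 l P ↔ Real.cos γ * inner ℝ z f + Real.sin γ * inner ℝ z n ≤ 0 ∧
      Real.cos γ * inner ℝ z n - Real.sin γ * inner ℝ z f ≤ 0 ∧ 0 ≤ inner ℝ z f := by
  rw [region4, Set.mem_inter_iff, h.mem_image_lowerHalfPlane, Set.mem_ofPred_eq, h.inner_nuisance,
    h.inner_interest, mul_nonneg_iff_of_pos_left h.pos_nuisance, ← neg_nonneg (a := a * _),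
    ← mul_neg, mul_nonneg_iff_of_pos_left h.pos_interest, neg_nonneg]

lemma mem_region5 (h : AdaptedFrame l P f n a b γ) (z : Plane) :
    z ∈ region5 l P ↔
      Real.cos γ * inner ℝ z n - Real.sin γ * inner ℝ z f ≤ 0 ∧ inner ℝ z f ≤ 0 := by
  rw [region5, Set.mem_ofPred_eq, h.inner_nuisance, h.inner_interest, ← neg_nonneg (a := a * _),
    ← mul_neg, mul_nonneg_iff_of_pos_left h.pos_interest, neg_nonneg, ← neg_nonneg (a := b * _),
    ← mul_neg, mul_nonneg_iff_of_pos_left h.pos_nuisance, neg_nonneg]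

lemma mem_region6 (h : AdaptedFrame l P f n a b γ) (z : Plane) :
    z ∈ region6 l P ↔ Real.cos γ * inner ℝ z f + Real.sin γ * inner ℝ z n ≤ 0 ∧
      0 ≤ Real.cos γ * inner ℝ z n - Real.sin γ * inner ℝ z f := by
  rw [region6, Set.mem_inter_iff, h.mem_image_lowerHalfPlane, Set.mem_ofPred_eq,
    h.inner_interest, mul_nonneg_iff_of_pos_left h.pos_interest]

/-- The square of the norm in the rotated frame. -/
lemma norm_sq_rotated (h : AdaptedFrame l P f n a b γ) (z : Plane) :
    ‖z‖ ^ 2 = (Real.cos γ * inner ℝ z f + Real.sin γ * inner ℝ z n) ^ 2 +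
      (Real.cos γ * inner ℝ z n - Real.sin γ * inner ℝ z f) ^ 2 := by
  rw [norm_sq_of_orthonormal h.orthonormal]
  linear_combination (inner ℝ z f ^ 2 + inner ℝ z n ^ 2) * (-Real.cos_sq_add_sin_sq γ)

/-! ### Squared distances to the cones -/

lemma infDist_nullCone_sq (h : AdaptedFrame l P f n a b γ) (z : Plane) :
    Metric.infDist z (whiten l P '' nullCone) ^ 2 =
      inner ℝ z n ^ 2 + min (inner ℝ z f) 0 ^ 2 := by
  obtain ⟨h1, h2, h3⟩ := orthonormal_pair_iff.1 h.orthonormal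
  refine infDist_sq_eq_of_forall_le (k := max (inner ℝ z f) 0 • f) ?_ ?_ fun k hk => ?_
  · rw [h.mem_image_nullCone]
    simp [inner_smul_left, h1, h3]
  · rw [norm_sq_of_orthonormal h.orthonormal]
    simp only [inner_sub_left, inner_smul_left, h3, real_inner_self_eq_norm_sq, h1]
    rcases le_total (inner ℝ z f) 0 with hx | hx <;> simp [hx]; ring
  · rw [h.mem_image_nullCone] at hk
    rw [norm_sq_of_orthonormal h.orthonormal, inner_sub_left, inner_sub_left, hk.1]
    rcases le_total (inner ℝ z f) 0 with hx | hx
    · rw [min_eq_left hx]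
      nlinarith [mul_nonneg (neg_nonneg.2 hx) hk.2]
    · rw [min_eq_right hx]
      nlinarith

/-- The unit inner normal is `cos γ • f + sin γ • n`. The nearest point is reached by moving along
it just enough to cancel a negative `w`. -/
lemma infDist_halfPlane_sq (h : AdaptedFrame l P f n a b γ) (z : Plane) :
    Metric.infDist z (whiten l P '' halfPlane) ^ 2 =
      min (Real.cos γ * inner ℝ z f + Real.sin γ * inner ℝ z n) 0 ^ 2 := by
  obtain ⟨h1, h2, h3⟩ := orthonormal_pair_iff.1 h.orthonormal
  have h5 : inner ℝ n f = 0 := by rw [real_inner_comm, h3]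
  have h4 := Real.cos_sq_add_sin_sq γ
  set w := Real.cos γ * inner ℝ z f + Real.sin γ * inner ℝ z n with hw
  have hk0 : Real.cos γ * inner ℝ (z - min w 0 • (Real.cos γ • f + Real.sin γ • n)) f +
      Real.sin γ * inner ℝ (z - min w 0 • (Real.cos γ • f + Real.sin γ • n)) n =
        w - min w 0 := by
    simp only [inner_sub_left, inner_smul_left, inner_add_left, h3, h5, real_inner_self_eq_norm_sq,
      h1, h2]
    simp
    linear_combination (- min w 0) * h4
  refine infDist_sq_eq_of_forall_le (k := z - min w 0 • (Real.cos γ • f + Real.sin γ • n)) ?_ ?_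
    fun k hk => ?_
  · rw [h.mem_image_halfPlane, hk0]
    exact sub_nonneg.2 (min_le_left _ _)
  · rw [sub_sub_cancel, norm_smul, (orthonormal_pair_iff.1 h.orthonormal_rotated).1, mul_one]
    simp
  · rw [h.mem_image_halfPlane] at hk
    rw [h.norm_sq_rotated, inner_sub_left, inner_sub_left]
    have hw' : Real.cos γ * (inner ℝ z f - inner ℝ k f) +
        Real.sin γ * (inner ℝ z n - inner ℝ k n) =
          w - (Real.cos γ * inner ℝ k f + Real.sin γ * inner ℝ k n) := by
      rw [hw]
      ring
    rw [hw']
    refine le_add_of_le_of_nonneg ?_ (sq_nonneg _)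
    rcases le_total w 0 with hx | hx
    · rw [min_eq_left hx]
      nlinarith [mul_nonneg (neg_nonneg.2 hx) hk]
    · rw [min_eq_right hx]
      nlinarith

lemma infDist_altCone_of_mem (h : AdaptedFrame l P f n a b γ) {z : Plane} (h0 : 0 ≤ inner ℝ z n)
    (h1 : 0 ≤ Real.cos γ * inner ℝ z f + Real.sin γ * inner ℝ z n) :
    Metric.infDist z (whiten l P '' altCone) ^ 2 = 0 := by
  rw [Metric.infDist_zero_of_mem ((h.mem_image_altCone z).2 ⟨h0, h1⟩), zero_pow two_ne_zero]

/-- The nearest point is the projection on the null ray, an edge of the cone. The two sign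
conditions hold on both region 3 and region 4. -/
lemma infDist_altCone_of_nonpos (h : AdaptedFrame l P f n a b γ) {z : Plane}
    (h0 : inner ℝ z n ≤ 0) (h1 : 0 ≤ inner ℝ z f) :
    Metric.infDist z (whiten l P '' altCone) ^ 2 = inner ℝ z n ^ 2 := by
  obtain ⟨k1, k2, k3⟩ := orthonormal_pair_iff.1 h.orthonormal
  refine infDist_sq_eq_of_forall_le (k := inner ℝ z f • f) ?_ ?_ fun k hk => ?_
  · rw [h.mem_image_altCone]
    simpa [inner_smul_left, k1, k3] using mul_nonneg h.cos_pos.le h1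
  · rw [norm_sq_of_orthonormal h.orthonormal]
    simp [inner_sub_left, inner_smul_left, k1, k3]
  · rw [h.mem_image_altCone] at hk
    rw [norm_sq_of_orthonormal h.orthonormal, inner_sub_left, inner_sub_left]
    nlinarith [mul_nonneg (neg_nonneg.2 h0) hk.1, sq_nonneg (inner ℝ z f - inner ℝ k f)]

/-- The nearest point of the half-plane is `p` times the unit vector along `u`; since `p ≥ 0` it
already lies in the quadrant. -/
lemma infDist_altCone_of_mem_region6 (h : AdaptedFrame l P f n a b γ) {z : Plane}
    (hz : z ∈ region6 l P) :
    Metric.infDist z (whiten l P '' altCone) ^ 2 =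
      Metric.infDist z (whiten l P '' halfPlane) ^ 2 := by
  obtain ⟨k1, k2, k3⟩ := orthonormal_pair_iff.1 h.orthonormal
  have k5 : inner ℝ n f = 0 := by rw [real_inner_comm, k3]
  have h4 := Real.cos_sq_add_sin_sq γ
  rw [h.mem_region6] at hz
  obtain ⟨h0, h1⟩ := hz
  rw [h.infDist_halfPlane_sq, min_eq_left h0]
  set w := Real.cos γ * inner ℝ z f + Real.sin γ * inner ℝ z n with hw
  set p := Real.cos γ * inner ℝ z n - Real.sin γ * inner ℝ z f with hp
  have hkn : inner ℝ (p • (Real.cos γ • n - Real.sin γ • f)) n = p * Real.cos γ := by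
    simp [inner_sub_left, inner_smul_left, k2, k3]
  have hkf : inner ℝ (p • (Real.cos γ • n - Real.sin γ • f)) f = - (p * Real.sin γ) := by
    simp [inner_sub_left, inner_smul_left, k1, k5]
  refine infDist_sq_eq_of_forall_le (k := p • (Real.cos γ • n - Real.sin γ • f)) ?_ ?_
    fun k hk => ?_
  · rw [h.mem_image_altCone, hkn, hkf]
    exact ⟨mul_nonneg h1 h.cos_pos.le, le_of_eq (by ring)⟩
  · rw [h.norm_sq_rotated, inner_sub_left, inner_sub_left, hkn, hkf]
    have e1 : Real.cos γ * (inner ℝ z f - -(p * Real.sin γ)) +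
        Real.sin γ * (inner ℝ z n - p * Real.cos γ) = w := by
      rw [hw]
      ring
    have e2 : Real.cos γ * (inner ℝ z n - p * Real.cos γ) -
        Real.sin γ * (inner ℝ z f - -(p * Real.sin γ)) = 0 := by
      linear_combination (-p) * h4 - hp
    rw [e1, e2]
    ring
  · rw [h.mem_image_altCone] at hk
    rw [h.norm_sq_rotated, inner_sub_left, inner_sub_left]
    have hw' : Real.cos γ * (inner ℝ z f - inner ℝ k f) +
        Real.sin γ * (inner ℝ z n - inner ℝ k n) =
          w - (Real.cos γ * inner ℝ k f + Real.sin γ * inner ℝ k n) := by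
      rw [hw]
      ring
    rw [hw']
    refine le_add_of_le_of_nonneg ?_ (sq_nonneg _)
    nlinarith [mul_nonneg (neg_nonneg.2 h0) hk.2]

/-- A point of the polar cone has nonpositive inner product with every cone element, so the origin
is nearest. -/
lemma infDist_altCone_of_mem_region5 (h : AdaptedFrame l P f n a b γ) {z : Plane}
    (hz : z ∈ region5 l P) :
    Metric.infDist z (whiten l P '' altCone) ^ 2 = ‖z‖ ^ 2 := by
  have ha := h.pos_interest
  have hb := h.pos_nuisance
  refine infDist_sq_eq_of_forall_le (k := 0) ?_ (by simp) ?_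
  · rw [h.mem_image_altCone]
    simp
  · rintro _ ⟨θ, hθ, rfl⟩
    have h1 : inner ℝ z (whiten l P θ) ≤ 0 := by
      rw [whiten_apply, inner_add_right, inner_smul_right, inner_smul_right]
      exact add_nonpos (mul_nonpos_of_nonneg_of_nonpos hθ.1 hz.1)
        (mul_nonpos_of_nonneg_of_nonpos hθ.2 hz.2)
    rw [norm_sub_sq_real]
    nlinarith [sq_nonneg ‖whiten l P θ‖]

/-- On region 6 the projection on the null cone is the origin. -/
lemma inner_nonpos_of_mem_region6 (h : AdaptedFrame l P f n a b γ) {z : Plane}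
    (hz : z ∈ region6 l P) : inner ℝ z f ≤ 0 := by
  rw [h.mem_region6] at hz
  have h4 := Real.cos_sq_add_sin_sq γ
  have : inner ℝ z f = Real.cos γ * (Real.cos γ * inner ℝ z f + Real.sin γ * inner ℝ z n) -
      Real.sin γ * (Real.cos γ * inner ℝ z n - Real.sin γ * inner ℝ z f) := by
    linear_combination (- inner ℝ z f) * h4
  rw [this]
  exact sub_nonpos_of_le ((mul_nonpos_of_nonneg_of_nonpos h.cos_pos.le hz.1).trans
    (mul_nonneg h.sin_nonneg hz.2))

/-! ### Values of the two statistics -/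

lemma distStat_altCone_region1 (h : AdaptedFrame l P f n a b γ) {z : Plane}
    (hz : z ∈ region1 l P) : distStat l P altCone z = ‖z‖ ^ 2 := by
  rw [h.mem_region1] at hz
  rw [distStat, h.infDist_altCone_of_mem hz.1 hz.2.1, h.infDist_nullCone_sq, min_eq_left hz.2.2,
    norm_sq_of_orthonormal h.orthonormal]
  ring

lemma distStat_altCone_region2 (h : AdaptedFrame l P f n a b γ) {z : Plane}
    (hz : z ∈ region2 l P) : distStat l P altCone z = inner ℝ z n ^ 2 := by
  rw [h.mem_region2] at hz
  rw [distStat, h.infDist_altCone_of_mem hz.2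
    (add_nonneg (mul_nonneg h.cos_pos.le hz.1) (mul_nonneg h.sin_nonneg hz.2)),
    h.infDist_nullCone_sq, min_eq_right hz.1]
  ring

/-- The null cone is at distance `‖z‖` and the quadrant at distance `|w|`; Pythagoras leaves `p²`.
-/
lemma distStat_altCone_region6 (h : AdaptedFrame l P f n a b γ) {z : Plane}
    (hz : z ∈ region6 l P) : distStat l P altCone z =
      (Real.cos γ * inner ℝ z n - Real.sin γ * inner ℝ z f) ^ 2 := by
  rw [distStat, h.infDist_altCone_of_mem_region6 hz, h.infDist_halfPlane_sq, h.infDist_nullCone_sq,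
    min_eq_left (h.inner_nonpos_of_mem_region6 hz), min_eq_left ((h.mem_region6 z).1 hz).1,
    add_comm, ← norm_sq_of_orthonormal h.orthonormal, h.norm_sq_rotated]
  ring

/-- Here the nearest point of the quadrant already lies on the null ray: its projection there on
regions 3 and 4, the origin on region 5. -/
lemma distStat_altCone_eq_zero (h : AdaptedFrame l P f n a b γ) {z : Plane}
    (hz : z ∈ region3 l P ∪ region4 l P ∪ region5 l P) : distStat l P altCone z = 0 := by
  have hC := h.cos_pos
  have hS := h.sin_nonneg
  rw [distStat, sub_eq_zero, h.infDist_nullCone_sq]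
  rcases hz with (hz | hz) | hz
  · rw [h.mem_region3] at hz
    have hx : 0 ≤ inner ℝ z f := by
      rw [← mul_nonneg_iff_of_pos_left hC]
      nlinarith [mul_nonneg hS (neg_nonneg.2 hz.1)]
    rw [h.infDist_altCone_of_nonpos hz.1 hx, min_eq_right hx]
    ring
  · rw [h.mem_region4] at hz
    have hy : inner ℝ z n ≤ 0 := by
      have h4 := Real.cos_sq_add_sin_sq γ
      have : inner ℝ z n = Real.sin γ * (Real.cos γ * inner ℝ z f + Real.sin γ * inner ℝ z n) +
          Real.cos γ * (Real.cos γ * inner ℝ z n - Real.sin γ * inner ℝ z f) := by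
        linear_combination (- inner ℝ z n) * h4
      rw [this]
      exact add_nonpos (mul_nonpos_of_nonneg_of_nonpos hS hz.1)
        (mul_nonpos_of_nonneg_of_nonpos hC.le hz.2.1)
    rw [h.infDist_altCone_of_nonpos hy hz.2.2, min_eq_right hz.2.2]
    ring
  · rw [h.infDist_altCone_of_mem_region5 hz, min_eq_left ((h.mem_region5 z).1 hz).2,
      norm_sq_of_orthonormal h.orthonormal]
    ring

lemma distStat_halfPlane (h : AdaptedFrame l P f n a b γ) (z : Plane) :
    distStat l P halfPlane z = inner ℝ z n ^ 2 + min (inner ℝ z f) 0 ^ 2 -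
      min (Real.cos γ * inner ℝ z f + Real.sin γ * inner ℝ z n) 0 ^ 2 := by
  rw [distStat, h.infDist_nullCone_sq, h.infDist_halfPlane_sq]

lemma distStat_halfPlane_eq_altCone (h : AdaptedFrame l P f n a b γ) {z : Plane}
    (hz : z ∈ region1 l P ∪ region2 l P ∪ region6 l P) :
    distStat l P halfPlane z = distStat l P altCone z := by
  rw [distStat, distStat, sub_right_inj]
  have hmem : ∀ {z}, z ∈ whiten l P '' altCone →
      Metric.infDist z (whiten l P '' halfPlane) ^ 2 =
        Metric.infDist z (whiten l P '' altCone) ^ 2 := fun hz => by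
    have hsub : altCone ⊆ halfPlane := fun θ hθ => hθ.2
    rw [Metric.infDist_zero_of_mem hz, Metric.infDist_zero_of_mem (Set.image_mono hsub hz)]
  rcases hz with (hz | hz) | hz
  · exact hmem hz.1
  · exact hmem hz.1
  · exact (h.infDist_altCone_of_mem_region6 hz).symm

lemma inner_div_norm_interest (h : AdaptedFrame l P f n a b γ) (z : Plane) :
    inner ℝ z (dirInterest l P) / ‖dirInterest l P‖ =
      Real.cos γ * inner ℝ z n - Real.sin γ * inner ℝ z f := by
  rw [h.inner_interest, h.norm_interest, mul_div_cancel_left₀ _ h.pos_interest.ne']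

lemma inner_div_norm_nuisance (h : AdaptedFrame l P f n a b γ) (z : Plane) :
    inner ℝ z (dirNuisance l P) / ‖dirNuisance l P‖ = inner ℝ z f := by
  rw [h.inner_nuisance, h.norm_nuisance, mul_div_cancel_left₀ _ h.pos_nuisance.ne']

lemma distStat_halfPlane_region3 (h : AdaptedFrame l P f n a b γ) {z : Plane}
    (hz : z ∈ region3 l P) : distStat l P halfPlane z =
      ‖z‖ ^ 2 - (inner ℝ z (dirNuisance l P) / ‖dirNuisance l P‖) ^ 2 := by
  rw [h.mem_region3] at hz
  have hx : 0 ≤ inner ℝ z f := by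
    rw [← mul_nonneg_iff_of_pos_left h.cos_pos]
    nlinarith [mul_nonneg h.sin_nonneg (neg_nonneg.2 hz.1)]
  rw [h.inner_div_norm_nuisance, h.distStat_halfPlane, min_eq_right hx, min_eq_right hz.2,
    norm_sq_of_orthonormal h.orthonormal]
  ring

lemma distStat_halfPlane_region4 (h : AdaptedFrame l P f n a b γ) {z : Plane}
    (hz : z ∈ region4 l P) : distStat l P halfPlane z =
      (inner ℝ z (dirInterest l P) / ‖dirInterest l P‖) ^ 2 -
        (inner ℝ z (dirNuisance l P) / ‖dirNuisance l P‖) ^ 2 := by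
  rw [h.mem_region4] at hz
  rw [h.inner_div_norm_nuisance, h.inner_div_norm_interest, h.distStat_halfPlane,
    min_eq_right hz.2.2, min_eq_left hz.1]
  linear_combination norm_sq_of_orthonormal h.orthonormal z |>.symm.trans (h.norm_sq_rotated z)

lemma distStat_halfPlane_region5 (h : AdaptedFrame l P f n a b γ) {z : Plane}
    (hz : z ∈ region5 l P) : distStat l P halfPlane z =
      (inner ℝ z (dirInterest l P) / ‖dirInterest l P‖) ^ 2 := by
  rw [h.mem_region5] at hz
  have hw : Real.cos γ * inner ℝ z f + Real.sin γ * inner ℝ z n ≤ 0 := by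
    rw [← neg_nonneg, ← mul_nonneg_iff_of_pos_left h.cos_pos]
    -- The identity behind this is `cos γ · w = x + sin γ · p`.
    nlinarith [mul_nonneg h.sin_nonneg (neg_nonneg.2 hz.1), Real.cos_sq_add_sin_sq γ]
  rw [h.inner_div_norm_interest, h.distStat_halfPlane, min_eq_left hz.2, min_eq_left hw]
  linear_combination norm_sq_of_orthonormal h.orthonormal z |>.symm.trans (h.norm_sq_rotated z)

end AdaptedFrame

end Geometry

/-! ### Laws of the statistics -/

section Laws

lemma measurable_distStat (l : Fin 2 → ℝ) (P : Matrix (Fin 2) (Fin 2) ℝ) (C : Set Plane) :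
    Measurable (distStat l P C) := by
  unfold distStat
  exact (((Metric.continuous_infDist_pt _).pow 2).sub
    ((Metric.continuous_infDist_pt _).pow 2)).measurable

namespace AdaptedFrame

variable {l : Fin 2 → ℝ} {P : Matrix (Fin 2) (Fin 2) ℝ} {f n : Plane} {a b γ : ℝ}

lemma measurableSet_altCone (h : AdaptedFrame l P f n a b γ) :
    MeasurableSet (whiten l P '' altCone) := by
  have : whiten l P '' altCone = {z | 0 ≤ inner ℝ z n} ∩
      {z | 0 ≤ Real.cos γ * inner ℝ z f + Real.sin γ * inner ℝ z n} := by
    ext z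
    exact h.mem_image_altCone z
  rw [this]
  exact (measurableSet_le (by fun_prop) (by fun_prop)).inter
    (measurableSet_le (by fun_prop) (by fun_prop))

lemma measurableSet_region1 (h : AdaptedFrame l P f n a b γ) : MeasurableSet (region1 l P) :=
  h.measurableSet_altCone.inter (measurableSet_le (by fun_prop) (by fun_prop))

lemma measurableSet_region2 (h : AdaptedFrame l P f n a b γ) : MeasurableSet (region2 l P) :=
  h.measurableSet_altCone.inter (measurableSet_le (by fun_prop) (by fun_prop))

lemma measurableSet_lowerHalfPlane (h : AdaptedFrame l P f n a b γ) :
    MeasurableSet (whiten l P '' {θ | θ 1 ≤ 0}) := by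
  have : whiten l P '' {θ | θ 1 ≤ 0} =
      {z | Real.cos γ * inner ℝ z f + Real.sin γ * inner ℝ z n ≤ 0} := by
    ext z
    exact h.mem_image_lowerHalfPlane z
  rw [this]
  exact measurableSet_le (by fun_prop) (by fun_prop)

lemma measurableSet_region6 (h : AdaptedFrame l P f n a b γ) : MeasurableSet (region6 l P) :=
  h.measurableSet_lowerHalfPlane.inter (measurableSet_le (by fun_prop) (by fun_prop))

lemma measurableSet_region345 (h : AdaptedFrame l P f n a b γ) :
    MeasurableSet (region3 l P ∪ region4 l P ∪ region5 l P) := by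
  have h3 : region3 l P = {z | inner ℝ z n ≤ 0} ∩
      {z | 0 ≤ Real.cos γ * inner ℝ z f + Real.sin γ * inner ℝ z n} := by
    ext z
    exact h.mem_region3 z
  refine (MeasurableSet.union ?_ ?_).union ?_
  · rw [h3]
    exact (measurableSet_le (by fun_prop) (by fun_prop)).inter
      (measurableSet_le (by fun_prop) (by fun_prop))
  · rw [region4, Set.ofPred_and]
    exact h.measurableSet_lowerHalfPlane.inter ((measurableSet_le (by fun_prop) (by fun_prop)).inter
      (measurableSet_le (by fun_prop) (by fun_prop)))
  · rw [region5, Set.ofPred_and]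
    exact (measurableSet_le (by fun_prop) (by fun_prop)).inter
      (measurableSet_le (by fun_prop) (by fun_prop))

lemma map_region1 (h : AdaptedFrame l P f n a b γ) :
    ((stdGaussian Plane).restrict (region1 l P)).map (distStat l P altCone) =
      ENNReal.ofReal (γ / (2 * Real.pi)) • chiSq 2 := by
  obtain ⟨h1, h2, h3⟩ := orthonormal_pair_iff.1 h.orthonormal
  -- In this frame region 1 is the sector of angles from `0`, at `n`, to `γ`, at the direction of
  -- `u`.
  have ho : Orthonormal ℝ ![n, -f] :=
    orthonormal_pair_iff.2 ⟨h2, by simpa using h1, by simp [real_inner_comm, h3]⟩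
  rw [← stdGaussian_sector ho h.angle_nonneg h.angle_lt, Measure.map_congr
    (ae_restrict_of_forall_mem h.measurableSet_region1 fun z hz => h.distStat_altCone_region1 hz)]
  congr 2
  ext z
  rw [h.mem_region1, Set.mem_ofPred_eq, inner_neg_right, mul_neg, sub_neg_eq_add,
    neg_nonneg, add_comm]
  tauto

lemma map_region2 (h : AdaptedFrame l P f n a b γ) :
    ((stdGaussian Plane).restrict (region2 l P)).map (distStat l P altCone) =
      ENNReal.ofReal (1 / 4) • chiSq 1 := by
  rw [← stdGaussian_quadrant h.orthonormal, Measure.map_congr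
    (ae_restrict_of_forall_mem h.measurableSet_region2 fun z hz => h.distStat_altCone_region2 hz)]
  congr 2
  ext z
  exact h.mem_region2 z

lemma map_region6 (h : AdaptedFrame l P f n a b γ) :
    ((stdGaussian Plane).restrict (region6 l P)).map (distStat l P altCone) =
      ENNReal.ofReal (1 / 4) • chiSq 1 := by
  obtain ⟨h1, h2, h3⟩ := orthonormal_pair_iff.1 h.orthonormal_rotated
  -- Region 6 is the quadrant between the outer normal of the half-plane and `u`.
  have ho := orthonormal_pair_iff.2
    ⟨(norm_neg _).trans h1, h2, by rw [inner_neg_left, h3, neg_zero]⟩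
  rw [← stdGaussian_quadrant ho, Measure.map_congr
    (ae_restrict_of_forall_mem h.measurableSet_region6 fun z hz => h.distStat_altCone_region6 hz)]
  simp_rw [inner_neg_right, inner_sub_right, inner_add_right, inner_smul_right]
  congr 2
  ext z
  rw [h.mem_region6, Set.mem_ofPred_eq, neg_nonneg]

lemma stdGaussian_boundary (h : AdaptedFrame l P f n a b γ) :
    stdGaussian Plane ({z | inner ℝ z f = 0} ∪ {z | inner ℝ z n = 0} ∪
      {z | Real.cos γ * inner ℝ z f + Real.sin γ * inner ℝ z n = 0} ∪
        {z | Real.cos γ * inner ℝ z n - Real.sin γ * inner ℝ z f = 0}) = 0 := by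
  have h1 := h.orthonormal.ne_zero 0
  have h2 := h.orthonormal.ne_zero 1
  have h3 := h.orthonormal_rotated.ne_zero 0
  have h4 := h.orthonormal_rotated.ne_zero 1
  have k3 := stdGaussian_line h3
  have k4 := stdGaussian_line h4
  simp only [Matrix.cons_val_zero, Matrix.cons_val_one, inner_sub_right, inner_add_right,
    inner_smul_right] at k3 k4
  exact measure_union_null (measure_union_null (measure_union_null (stdGaussian_line h1)
    (stdGaussian_line h2)) k3) k4

lemma aedisjoint_of_inter_subset (h : AdaptedFrame l P f n a b γ) {A B : Set Plane}
    (hAB : ∀ z ∈ A, z ∈ B → inner ℝ z f = 0 ∨ inner ℝ z n = 0 ∨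
      Real.cos γ * inner ℝ z f + Real.sin γ * inner ℝ z n = 0 ∨
        Real.cos γ * inner ℝ z n - Real.sin γ * inner ℝ z f = 0) :
    AEDisjoint (stdGaussian Plane) A B := by
  refine measure_mono_null (fun z hz => ?_) h.stdGaussian_boundary
  rcases hAB z hz.1 hz.2 with h | h | h | h
  · exact Or.inl (Or.inl (Or.inl h))
  · exact Or.inl (Or.inl (Or.inr h))
  · exact Or.inl (Or.inr h)
  · exact Or.inr h

lemma aedisjoint_region2_region6 (h : AdaptedFrame l P f n a b γ) :
    AEDisjoint (stdGaussian Plane) (region2 l P) (region6 l P) := by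
  refine h.aedisjoint_of_inter_subset fun z h2 h6 => ?_
  rw [h.mem_region2] at h2
  rw [h.mem_region6] at h6
  exact Or.inr (Or.inr (Or.inl (le_antisymm h6.1
    (add_nonneg (mul_nonneg h.cos_pos.le h2.1) (mul_nonneg h.sin_nonneg h2.2)))))

lemma aedisjoint_region1_region26 (h : AdaptedFrame l P f n a b γ) :
    AEDisjoint (stdGaussian Plane) (region1 l P) (region2 l P ∪ region6 l P) := by
  refine h.aedisjoint_of_inter_subset fun z h1 h26 => ?_
  rw [h.mem_region1] at h1
  rw [Set.mem_union, h.mem_region2, h.mem_region6] at h26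
  rcases h26 with h2 | h6
  · exact Or.inl (le_antisymm h1.2.2 h2.1)
  · exact Or.inr (Or.inr (Or.inl (le_antisymm h6.1 h1.2.1)))

lemma aedisjoint_region126_region345 (h : AdaptedFrame l P f n a b γ) :
    AEDisjoint (stdGaussian Plane) (region1 l P ∪ (region2 l P ∪ region6 l P))
      (region3 l P ∪ region4 l P ∪ region5 l P) := by
  refine h.aedisjoint_of_inter_subset fun z h126 h345 => ?_
  simp only [Set.mem_union, h.mem_region1, h.mem_region2, h.mem_region3, h.mem_region4,
    h.mem_region5, h.mem_region6] at h126 h345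
  -- After generalization `x, y, w, p` are unrelated; `hw` and `hp` keep the only relations that the
  -- case analysis uses.
  have hw : 0 ≤ inner ℝ z f → 0 ≤ inner ℝ z n →
      0 ≤ Real.cos γ * inner ℝ z f + Real.sin γ * inner ℝ z n := fun hx hy =>
    add_nonneg (mul_nonneg h.cos_pos.le hx) (mul_nonneg h.sin_nonneg hy)
  have hp : inner ℝ z f ≤ 0 → 0 ≤ inner ℝ z n →
      0 ≤ Real.cos γ * inner ℝ z n - Real.sin γ * inner ℝ z f := fun hx hy =>
    sub_nonneg.2 ((mul_nonpos_of_nonneg_of_nonpos h.sin_nonneg hx).trans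
      (mul_nonneg h.cos_pos.le hy))
  generalize Real.cos γ * inner ℝ z f + Real.sin γ * inner ℝ z n = w at *
  generalize Real.cos γ * inner ℝ z n - Real.sin γ * inner ℝ z f = p at *
  generalize (inner ℝ z f : ℝ) = x at *
  generalize (inner ℝ z n : ℝ) = y at *
  grind

/-- Pure sign logic: for `w ≥ 0` split by `y` and then `x`, for `w ≤ 0` by `p` and then `x`. -/
lemma region_cover (h : AdaptedFrame l P f n a b γ) :
    region1 l P ∪ (region2 l P ∪ region6 l P) ∪ (region3 l P ∪ region4 l P ∪ region5 l P) =
      Set.univ := by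
  refine Set.eq_univ_of_forall fun z => ?_
  simp only [Set.mem_union, h.mem_region1, h.mem_region2, h.mem_region3, h.mem_region4,
    h.mem_region5, h.mem_region6]
  generalize Real.cos γ * inner ℝ z f + Real.sin γ * inner ℝ z n = w
  generalize Real.cos γ * inner ℝ z n - Real.sin γ * inner ℝ z f = p
  grind

lemma map_region26 (h : AdaptedFrame l P f n a b γ) :
    ((stdGaussian Plane).restrict (region2 l P ∪ region6 l P)).map (distStat l P altCone) =
      ENNReal.ofReal (1 / 2) • chiSq 1 := by
  rw [Measure.restrict_union₀ h.aedisjoint_region2_region6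
    h.measurableSet_region6.nullMeasurableSet, Measure.map_add _ _ (measurable_distStat _ _ _),
    h.map_region2, h.map_region6, ← add_smul, ← ENNReal.ofReal_add (by norm_num) (by norm_num)]
  norm_num

lemma restrict_add_restrict (h : AdaptedFrame l P f n a b γ) :
    (stdGaussian Plane).restrict (region1 l P) +
      (stdGaussian Plane).restrict (region2 l P ∪ region6 l P) +
        (stdGaussian Plane).restrict (region3 l P ∪ region4 l P ∪ region5 l P) =
          stdGaussian Plane := by
  rw [← Measure.restrict_union₀ h.aedisjoint_region1_region26
      (h.measurableSet_region2.union h.measurableSet_region6).nullMeasurableSet,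
    ← Measure.restrict_union₀ h.aedisjoint_region126_region345
      h.measurableSet_region345.nullMeasurableSet, h.region_cover, Measure.restrict_univ]

lemma weight_nonneg (h : AdaptedFrame l P f n a b γ) : 0 ≤ γ / (2 * Real.pi) :=
  div_nonneg h.angle_nonneg (by positivity)

lemma weight_lt (h : AdaptedFrame l P f n a b γ) : γ / (2 * Real.pi) < 1 / 4 := by
  rw [div_lt_iff₀ (by positivity)]
  linarith [h.angle_lt]

/-- The value is what the other regions leave of the total mass `1`; no angle is measured here. -/
lemma stdGaussian_region345 (h : AdaptedFrame l P f n a b γ) :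
    stdGaussian Plane (region3 l P ∪ region4 l P ∪ region5 l P) =
      ENNReal.ofReal (1 / 2 - γ / (2 * Real.pi)) := by
  have h1 := congrArg (fun m => m Set.univ) h.map_region1
  have h2 := congrArg (fun m => m Set.univ) h.map_region26
  have h3 := congrArg (fun m => m Set.univ) h.restrict_add_restrict
  simp only [Measure.map_apply (measurable_distStat _ _ _) MeasurableSet.univ, Set.preimage_univ,
    Measure.smul_apply, measure_univ, smul_eq_mul, mul_one, Measure.add_apply] at h1 h2 h3
  rw [h1, h2, ← ENNReal.ofReal_add h.weight_nonneg (by norm_num),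
    Measure.restrict_apply_univ] at h3
  have h4 : ENNReal.ofReal (γ / (2 * Real.pi) + 1 / 2) +
      ENNReal.ofReal (1 / 2 - γ / (2 * Real.pi)) = 1 := by
    rw [← ENNReal.ofReal_add (by linarith [h.weight_nonneg]) (by linarith [h.weight_lt]),
      ← ENNReal.ofReal_one]
    congr 1
    ring
  exact (ENNReal.add_right_inj ENNReal.ofReal_ne_top).1 (h3.trans h4.symm)

lemma map_region345 (h : AdaptedFrame l P f n a b γ) :
    ((stdGaussian Plane).restrict (region3 l P ∪ region4 l P ∪ region5 l P)).map
        (distStat l P altCone) = ENNReal.ofReal (1 / 2 - γ / (2 * Real.pi)) • chiSq 0 := by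
  rw [Measure.map_congr (g := fun _ => (0 : ℝ)) (ae_restrict_of_forall_mem
      h.measurableSet_region345 fun z hz => h.distStat_altCone_eq_zero hz), Measure.map_const,
    Measure.restrict_apply_univ, h.stdGaussian_region345, chiSq_zero]

lemma map_distStat_altCone (h : AdaptedFrame l P f n a b γ) :
    (stdGaussian Plane).map (distStat l P altCone) =
      chiBarSq (1 / 2 - γ / (2 * Real.pi)) (1 / 2) (γ / (2 * Real.pi)) := by
  have hm := measurable_distStat l P altCone
  conv_lhs => rw [← h.restrict_add_restrict]
  rw [Measure.map_add _ _ hm, Measure.map_add _ _ hm, h.map_region1, h.map_region26,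
    h.map_region345, chiBarSq]
  abel

/-! ### The half-plane alternative -/

lemma distStat_halfPlane_nonneg (h : AdaptedFrame l P f n a b γ) (z : Plane) :
    0 ≤ distStat l P halfPlane z := by
  have hsub : whiten l P '' nullCone ⊆ whiten l P '' halfPlane :=
    Set.image_mono fun θ hθ => hθ.2
  have hne : (whiten l P '' nullCone).Nonempty := ⟨0, (h.mem_image_nullCone 0).2 (by simp)⟩
  exact sub_nonneg.2 (pow_le_pow_left₀ Metric.infDist_nonneg
    (Metric.infDist_le_infDist_of_subset hsub hne) 2)

/-- The statistic for the half-plane alternative has no atom at `0`. -/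
lemma stdGaussian_distStat_halfPlane_eq_zero (h : AdaptedFrame l P f n a b γ) :
    stdGaussian Plane {z | distStat l P halfPlane z = 0} = 0 := by
  obtain ⟨h1, h2, h3⟩ := orthonormal_pair_iff.1 h.orthonormal
  have h5 : inner ℝ n f = 0 := by rw [real_inner_comm, h3]
  have hC := h.cos_pos
  have hne : ∀ s : ℝ, Real.cos γ • f + s • n ≠ 0 := by
    intro s hs
    have := congrArg (fun v => inner ℝ v f) hs
    simp [inner_add_left, inner_smul_left, h1, h5] at this
    exact hC.ne' this
  -- Where `x ≥ 0` and `w ≤ 0` the statistic is `y² - w²`, with zeros on the lines `w = y` and `w =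
  -- -y`; these are the values `s = sin γ ∓ 1`.
  have k1 := stdGaussian_line (hne (Real.sin γ - 1))
  have k2 := stdGaussian_line (hne (Real.sin γ + 1))
  simp only [inner_add_right, inner_smul_right] at k1 k2
  refine measure_mono_null (fun z hz => ?_)
    (measure_union_null (measure_union_null h.stdGaussian_boundary k1) k2)
  rw [Set.mem_ofPred_eq, h.distStat_halfPlane] at hz
  have hr : inner ℝ z f ^ 2 + inner ℝ z n ^ 2 = _ :=
    (norm_sq_of_orthonormal h.orthonormal z).symm.trans (h.norm_sq_rotated z)
  set w := Real.cos γ * inner ℝ z f + Real.sin γ * inner ℝ z n with hw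
  rcases le_total (inner ℝ z f) 0 with hx | hx <;> rcases le_total w 0 with hw0 | hw0
  · rw [min_eq_left hx, min_eq_left hw0] at hz
    refine Or.inl (Or.inl (Or.inr ?_))
    exact (pow_eq_zero_iff two_ne_zero).1 (by linarith)
  · rw [min_eq_left hx, min_eq_right hw0] at hz
    refine Or.inl (Or.inl (Or.inl (Or.inl (Or.inl ?_))))
    exact (pow_eq_zero_iff two_ne_zero).1
      (by nlinarith [sq_nonneg (inner ℝ z f), sq_nonneg (inner ℝ z n)])
  · rw [min_eq_right hx, min_eq_left hw0] at hz
    have hz' : (w - inner ℝ z n) * (w + inner ℝ z n) = 0 := by linarith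
    rcases mul_eq_zero.1 hz' with h0 | h0
    · refine Or.inl (Or.inr ?_)
      rw [Set.mem_ofPred_eq]
      linarith
    · refine Or.inr ?_
      rw [Set.mem_ofPred_eq]
      linarith
  · rw [min_eq_right hx, min_eq_right hw0] at hz
    refine Or.inl (Or.inl (Or.inl (Or.inl (Or.inr ?_))))
    exact (pow_eq_zero_iff two_ne_zero).1 (by linarith)

/-- The terms `min(x,0)²` and `min(w,0)²` have equal finite means and cancel, which leaves the mean
of `y²`. The subtracted term is moved across first, as the integrals take values in `ENNReal`. -/
lemma lintegral_distStat_halfPlane (h : AdaptedFrame l P f n a b γ) :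
    ∫⁻ z, ENNReal.ofReal (distStat l P halfPlane z) ∂(stdGaussian Plane) = 1 := by
  obtain ⟨h1, h2, -⟩ := orthonormal_pair_iff.1 h.orthonormal
  have hm := (orthonormal_pair_iff.1 h.orthonormal_rotated).1
  have key : ∀ z : Plane, ENNReal.ofReal (distStat l P halfPlane z) +
      ENNReal.ofReal (min (inner ℝ z (Real.cos γ • f + Real.sin γ • n)) 0 ^ 2) =
        ENNReal.ofReal (inner ℝ z n ^ 2) + ENNReal.ofReal (min (inner ℝ z f) 0 ^ 2) := by
    intro z
    rw [← ENNReal.ofReal_add (h.distStat_halfPlane_nonneg z) (sq_nonneg _),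
      ← ENNReal.ofReal_add (sq_nonneg _) (sq_nonneg _), h.distStat_halfPlane, inner_add_right,
      inner_smul_right, inner_smul_right, sub_add_cancel]
  have hi := lintegral_congr (μ := stdGaussian Plane) key
  rw [lintegral_add_right _ (by fun_prop), lintegral_add_right _ (by fun_prop),
    lintegral_min_inner_sq_stdGaussian hm, lintegral_min_inner_sq_stdGaussian h1,
    lintegral_inner_sq_stdGaussian h2] at hi
  exact (ENNReal.add_left_inj ENNReal.ofReal_ne_top).1 hi

/-- The statistic for the half-plane alternative has no chi-bar-squared law: it has no atom at `0`
and mean `1`, so only the law `χ²₁` is possible, but it dominates a positive multiple of `χ²₂`. -/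
lemma map_distStat_halfPlane_ne (h : AdaptedFrame l P f n a b γ) (hγ : 0 < γ) (w₀ w₁ w₂ : ℝ) :
    (stdGaussian Plane).map (distStat l P halfPlane) ≠ chiBarSq w₀ w₁ w₂ := by
  intro heq
  have hm := measurable_distStat l P halfPlane
  have h0 : ENNReal.ofReal w₀ = 0 := by
    have := congrArg (fun m => m {0}) heq
    simp only [Measure.map_apply hm (measurableSet_singleton _), chiBarSq, chiSq_zero,
      Measure.add_apply, Measure.smul_apply, smul_eq_mul] at this
    rw [show distStat l P halfPlane ⁻¹' {0} = {z | distStat l P halfPlane z = 0} from rfl,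
      h.stdGaussian_distStat_halfPlane_eq_zero] at this
    -- A vanishing sum of nonnegative terms suffices; the masses of `χ²₁` and `χ²₂` at `0` are not
    -- needed.
    simpa using (add_eq_zero.1 (add_eq_zero.1 this.symm).1).1
  have hmass : ENNReal.ofReal w₁ + ENNReal.ofReal w₂ = 1 := by
    have := congrArg (fun m => m Set.univ) heq
    simp only [Measure.map_apply hm MeasurableSet.univ, chiBarSq, h0,
      Measure.add_apply, Measure.smul_apply, smul_eq_mul, Set.preimage_univ, measure_univ,
      mul_one, zero_add] at this
    exact this.symm
  have hmean : ENNReal.ofReal w₁ + ENNReal.ofReal w₂ * 2 = 1 := by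
    have := congrArg (fun m => ∫⁻ t, ENNReal.ofReal t ∂m) heq
    simp only [chiBarSq, lintegral_add_measure, lintegral_smul_measure,
      lintegral_ofReal_chiSq_one, lintegral_ofReal_chiSq_two, h0, smul_eq_mul, zero_mul,
      zero_add, mul_one] at this
    rw [lintegral_map (by fun_prop) hm, h.lintegral_distStat_halfPlane] at this
    exact this.symm
  have h2 : ENNReal.ofReal w₂ = 0 := by
    rw [mul_two, ← add_assoc, hmass] at hmean
    exact (ENNReal.add_right_inj ENNReal.one_ne_top).1 (by rw [hmean, add_zero])
  have hq : 0 < γ / (2 * Real.pi) := by positivity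
  refine not_smul_chiSq_two_le_smul_chiSq_one (w := w₁) hq ?_
  calc ENNReal.ofReal (γ / (2 * Real.pi)) • chiSq 2
      = ((stdGaussian Plane).restrict (region1 l P)).map (distStat l P halfPlane) := by
        rw [← h.map_region1]
        exact Measure.map_congr (ae_restrict_of_forall_mem h.measurableSet_region1 fun z hz =>
          (h.distStat_halfPlane_eq_altCone (Or.inl (Or.inl hz))).symm)
    _ ≤ (stdGaussian Plane).map (distStat l P halfPlane) :=
        Measure.map_mono Measure.restrict_le_self hm
    _ = ENNReal.ofReal w₁ • chiSq 1 := by simp [heq, chiBarSq, h0, h2]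

lemma angle_dirInterest_dirNuisance (h : AdaptedFrame l P f n a b γ) :
    InnerProductGeometry.angle (dirInterest l P) (dirNuisance l P) = Real.pi / 2 + γ := by
  obtain ⟨h1, h2, h3⟩ := orthonormal_pair_iff.1 h.orthonormal
  have h5 : inner ℝ n f = 0 := by rw [real_inner_comm, h3]
  have hcos : inner ℝ (Real.cos γ • n - Real.sin γ • f) f = Real.cos (Real.pi / 2 + γ) := by
    rw [add_comm, Real.cos_add_pi_div_two]
    simp [inner_sub_left, inner_smul_left, h1, h5]
  rw [h.interest_eq, h.nuisance_eq, InnerProductGeometry.angle_smul_left_of_pos _ _ h.pos_interest,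
    InnerProductGeometry.angle_smul_right_of_pos _ _ h.pos_nuisance, InnerProductGeometry.angle,
    (orthonormal_pair_iff.1 h.orthonormal_rotated).2.1, h1, hcos, mul_one, div_one,
    Real.arccos_cos (by linarith [h.angle_nonneg, Real.pi_pos]) (by linarith [h.angle_lt])]

end AdaptedFrame

end Laws

/-! ### Whitening and the adapted frame -/

section Whitening

variable {I P : Matrix (Fin 2) (Fin 2) ℝ} {l : Fin 2 → ℝ}

lemma whitening_transpose_mul_self (hI : I.PosDef) (hP : P ∈ Matrix.orthogonalGroup (Fin 2) ℝ)
    (hdecomp : I = P * Matrix.diagonal l * Pᵀ) :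
    (Matrix.diagonal (fun i => √(l i)) * Pᵀ)ᵀ * (Matrix.diagonal (fun i => √(l i)) * Pᵀ) = I := by
  have hP' : Pᵀ * P = 1 := by
    simpa [Matrix.star_eq_conjTranspose] using (Matrix.mem_orthogonalGroup_iff' (Fin 2) ℝ).1 hP
  -- `diag l = Pᵀ I P` is positive semidefinite, so the real square roots square back to `l`.
  have hl : ∀ i, 0 ≤ l i := by
    have h1 := hI.posSemidef.conjTranspose_mul_mul_same P
    rw [Matrix.conjTranspose_eq_transpose_of_trivial, hdecomp] at h1
    have h2 : Pᵀ * (P * Matrix.diagonal l * Pᵀ) * P = Matrix.diagonal l := by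
      rw [← mul_assoc, ← mul_assoc, hP', one_mul, mul_assoc, hP', mul_one]
    rw [h2] at h1
    exact Matrix.posSemidef_diagonal_iff.1 h1
  rw [Matrix.transpose_mul, Matrix.transpose_transpose, Matrix.diagonal_transpose, mul_assoc,
    ← mul_assoc (Matrix.diagonal _) (Matrix.diagonal _), Matrix.diagonal_mul_diagonal, hdecomp,
    mul_assoc]
  simp_rw [fun i => Real.mul_self_sqrt (hl i)]

lemma inner_whiten_whiten (hI : I.PosDef) (hP : P ∈ Matrix.orthogonalGroup (Fin 2) ℝ)
    (hdecomp : I = P * Matrix.diagonal l * Pᵀ) (x y : Plane) :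
    inner ℝ (whiten l P x) (whiten l P y) = y.ofLp ⬝ᵥ (I *ᵥ x.ofLp) := by
  rw [← whitening_transpose_mul_self hI hP hdecomp, whiten]
  simp only [EuclideanSpace.inner_eq_star_dotProduct, Matrix.toLpLin_apply, star_trivial]
  generalize Matrix.diagonal (fun i => √(l i)) * Pᵀ = L
  rw [← Matrix.mulVec_mulVec, Matrix.dotProduct_mulVec _ Lᵀ, Matrix.vecMul_transpose,
    dotProduct_comm]

lemma quadStat_eq_distStat (hI : I.PosDef) (hP : P ∈ Matrix.orthogonalGroup (Fin 2) ℝ)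
    (hdecomp : I = P * Matrix.diagonal l * Pᵀ) {C : Set Plane} (hC : C.Nonempty) (z : Plane) :
    quadStat I C z = distStat l P C (whiten l P z) := by
  have h0 : nullCone.Nonempty := ⟨0, by simp [nullCone]⟩
  rw [quadStat, distStat, ← iInf_dist_sq_eq_infDist_sq _ h0, ← iInf_dist_sq_eq_infDist_sq _ hC]
  simp_rw [← inner_whiten_whiten hI hP hdecomp, real_inner_self_eq_norm_sq, map_sub,
    ← dist_eq_norm]

/-- The adjugate swaps the diagonal and negates the off-diagonal entries. This sign makes the
whitened quadrant obtuse when `ρ > 0`. -/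
lemma corr_eq (hI : I.PosDef) : corr I = - I 0 1 / √(I 0 0 * I 1 1) := by
  have hd := hI.det_pos
  have h01 : I⁻¹ 0 1 = I.det⁻¹ * - I 0 1 := by
    simp [Matrix.inv_def, Matrix.adjugate_fin_two]
  have h00 : I⁻¹ 0 0 = I.det⁻¹ * I 1 1 := by
    simp [Matrix.inv_def, Matrix.adjugate_fin_two]
  have h11 : I⁻¹ 1 1 = I.det⁻¹ * I 0 0 := by
    simp [Matrix.inv_def, Matrix.adjugate_fin_two]
  rw [corr, h01, h00, h11, mul_mul_mul_comm, Real.sqrt_mul (by positivity),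
    Real.sqrt_mul_self (by positivity), mul_div_mul_left _ _ (by positivity), mul_comm (I 1 1)]

/-- Gram–Schmidt applied to `v, u`: removing from `u/‖u‖` its component `-ρ` along `f` leaves a
vector of squared norm `1 - ρ² = cos² γ`. -/
lemma exists_adaptedFrame (hI : I.PosDef) (hP : P ∈ Matrix.orthogonalGroup (Fin 2) ℝ)
    (hdecomp : I = P * Matrix.diagonal l * Pᵀ) (hρ : 0 ≤ corr I) :
    ∃ f n a b, AdaptedFrame l P f n a b (Real.arcsin (corr I)) := by
  have h00 : 0 < I 0 0 := hI.diag_pos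
  have h11 : 0 < I 1 1 := hI.diag_pos
  have hdet := hI.det_pos
  have hsymm : I 1 0 = I 0 1 := by simpa using hI.isHermitian.apply 0 1
  rw [Matrix.det_fin_two, hsymm] at hdet
  have huu : ‖dirInterest l P‖ ^ 2 = I 0 0 := by
    rw [← real_inner_self_eq_norm_sq, dirInterest, inner_whiten_whiten hI hP hdecomp]
    simp
  have hvv : ‖dirNuisance l P‖ ^ 2 = I 1 1 := by
    rw [← real_inner_self_eq_norm_sq, dirNuisance, inner_whiten_whiten hI hP hdecomp]
    simp
  have huv : inner ℝ (dirInterest l P) (dirNuisance l P) = I 0 1 := by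
    rw [dirInterest, dirNuisance, inner_whiten_whiten hI hP hdecomp]
    simp [hsymm]
  set u := dirInterest l P
  set v := dirNuisance l P
  have ha : 0 < ‖u‖ := by
    rw [norm_pos_iff]
    rintro h
    simp [h] at huu
    linarith
  have hb : 0 < ‖v‖ := by
    rw [norm_pos_iff]
    rintro h
    simp [h] at hvv
    linarith
  have hcorr : I 0 1 = - corr I * (‖u‖ * ‖v‖) := by
    rw [corr_eq hI, ← huu, ← hvv, ← mul_pow, Real.sqrt_sq (by positivity)]
    field_simp
  -- The positive determinant is `(‖u‖ ‖v‖)² (1 - ρ²)`.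
  have hlt : corr I ^ 2 < 1 := by
    rw [hcorr, ← huu, ← hvv] at hdet
    have : 0 < (‖u‖ * ‖v‖) ^ 2 * (1 - corr I ^ 2) := by nlinarith
    have := (pos_iff_pos_of_mul_pos this).1 (by positivity)
    linarith
  have hle : corr I < 1 := by nlinarith
  set ρ := corr I
  have hsin : Real.sin (Real.arcsin ρ) = ρ := Real.sin_arcsin (by linarith) hle.le
  have hcos : Real.cos (Real.arcsin ρ) ^ 2 = 1 - ρ ^ 2 := by
    rw [Real.cos_sq', hsin]
  have hγ1 : Real.arcsin ρ < Real.pi / 2 := Real.arcsin_lt_pi_div_two.2 hle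
  have hγ0 : 0 ≤ Real.arcsin ρ := Real.arcsin_nonneg.2 hρ
  have hC : 0 < Real.cos (Real.arcsin ρ) :=
    Real.cos_pos_of_mem_Ioo ⟨by linarith [Real.pi_pos], hγ1⟩
  set c := Real.cos (Real.arcsin ρ)
  refine ⟨‖v‖⁻¹ • v, c⁻¹ • (‖u‖⁻¹ • u + ρ • ‖v‖⁻¹ • v), ‖u‖, ‖v‖, ?_, ha, hb, hγ0, hγ1, ?_, ?_⟩
  · have hff : inner ℝ (‖v‖⁻¹ • v) (‖v‖⁻¹ • v) = 1 := by
      rw [real_inner_smul_left, real_inner_smul_right, real_inner_self_eq_norm_sq]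
      field_simp
    have hee : inner ℝ (‖u‖⁻¹ • u) (‖u‖⁻¹ • u) = 1 := by
      rw [real_inner_smul_left, real_inner_smul_right, real_inner_self_eq_norm_sq]
      field_simp
    have hef : inner ℝ (‖u‖⁻¹ • u) (‖v‖⁻¹ • v) = -ρ := by
      rw [real_inner_smul_left, real_inner_smul_right, huv, hcorr]
      field_simp
    have hfe : inner ℝ (‖v‖⁻¹ • v) (‖u‖⁻¹ • u) = -ρ := by rw [real_inner_comm, hef]
    generalize ‖v‖⁻¹ • v = f at *
    generalize ‖u‖⁻¹ • u = e at *
    refine orthonormal_pair_iff.2 ⟨?_, ?_, ?_⟩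
    · rwa [← pow_eq_one_iff_of_nonneg (norm_nonneg _) two_ne_zero, ← real_inner_self_eq_norm_sq]
    · rw [← pow_eq_one_iff_of_nonneg (norm_nonneg _) two_ne_zero, ← real_inner_self_eq_norm_sq,
        real_inner_smul_left, real_inner_smul_right, inner_add_left, inner_add_right,
        inner_add_right, real_inner_smul_left, real_inner_smul_left, real_inner_smul_right,
        real_inner_smul_right, hff, hee, hef, hfe]
      have : 1 + ρ * -ρ + (ρ * -ρ + ρ * (ρ * 1)) = c ^ 2 := by
        rw [hcos]
        ring
      rw [this]
      field_simp
    · rw [real_inner_smul_right, inner_add_right, real_inner_smul_right, hff, hfe]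
      ring
  · rw [hsin, smul_inv_smul₀ hC.ne', add_sub_cancel_right, smul_inv_smul₀ ha.ne']
  · rw [smul_inv_smul₀ hb.ne']

end Whitening

end BoundaryLRT

theorem mainTheorem2
    (I : Matrix (Fin 2) (Fin 2) ℝ) (hI : I.PosDef)
    (P : Matrix (Fin 2) (Fin 2) ℝ) (hP : P ∈ Matrix.orthogonalGroup (Fin 2) ℝ)
    (l : Fin 2 → ℝ) (hdecomp : I = P * Matrix.diagonal l * Pᵀ)
    (hρ : 0 ≤ BoundaryLRT.corr I)
    {Ω : Type*} [MeasurableSpace Ω] (μ : Measure Ω) (Z : Ω → Plane)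
    (hZ : HasLaw Z (multivariateGaussian 0 I⁻¹) μ) :
    -- the whitened vector is standard Gaussian
    HasLaw (fun ω => BoundaryLRT.whiten l P (Z ω)) (stdGaussian Plane) μ ∧
    -- the law of the statistic, in whitened and in original coordinates
    HasLaw (fun ω => BoundaryLRT.distStat l P BoundaryLRT.altCone (BoundaryLRT.whiten l P (Z ω)))
      (BoundaryLRT.chiBarSq (1 / 2 - BoundaryLRT.weight I) (1 / 2) (BoundaryLRT.weight I)) μ ∧
    HasLaw (fun ω => BoundaryLRT.quadStat I BoundaryLRT.altCone (Z ω))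
      (BoundaryLRT.chiBarSq (1 / 2 - BoundaryLRT.weight I) (1 / 2) (BoundaryLRT.weight I)) μ ∧
    -- the opening angle of the whitened quadrant
    InnerProductGeometry.angle (BoundaryLRT.dirInterest l P) (BoundaryLRT.dirNuisance l P) =
      Real.pi / 2 + Real.arcsin (BoundaryLRT.corr I) ∧
    -- the contributions of the regions
    ((stdGaussian Plane).restrict (BoundaryLRT.region1 l P)).map
        (BoundaryLRT.distStat l P BoundaryLRT.altCone) =
      ENNReal.ofReal (BoundaryLRT.weight I) • BoundaryLRT.chiSq 2 ∧
    ((stdGaussian Plane).restrict (BoundaryLRT.region2 l P ∪ BoundaryLRT.region6 l P)).map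
        (BoundaryLRT.distStat l P BoundaryLRT.altCone) =
      ENNReal.ofReal (1 / 2) • BoundaryLRT.chiSq 1 ∧
    ((stdGaussian Plane).restrict
        (BoundaryLRT.region3 l P ∪ BoundaryLRT.region4 l P ∪ BoundaryLRT.region5 l P)).map
        (BoundaryLRT.distStat l P BoundaryLRT.altCone) =
      ENNReal.ofReal (1 / 2 - BoundaryLRT.weight I) • BoundaryLRT.chiSq 0 ∧
    (∀ z ∈ BoundaryLRT.region3 l P ∪ BoundaryLRT.region4 l P ∪ BoundaryLRT.region5 l P,
      BoundaryLRT.distStat l P BoundaryLRT.altCone z = 0) ∧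
    -- the half-plane as alternative cone: the same statistic on regions 1, 2, 6, other terms on
    -- regions 3, 4, 5, and no chi-bar-squared law for positive correlation
    (∀ z ∈ BoundaryLRT.region1 l P ∪ BoundaryLRT.region2 l P ∪ BoundaryLRT.region6 l P,
      BoundaryLRT.distStat l P BoundaryLRT.halfPlane z =
        BoundaryLRT.distStat l P BoundaryLRT.altCone z) ∧
    (∀ z ∈ BoundaryLRT.region3 l P, BoundaryLRT.distStat l P BoundaryLRT.halfPlane z =
      ‖z‖ ^ 2 - (inner ℝ z (BoundaryLRT.dirNuisance l P) / ‖BoundaryLRT.dirNuisance l P‖) ^ 2) ∧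
    (∀ z ∈ BoundaryLRT.region4 l P, BoundaryLRT.distStat l P BoundaryLRT.halfPlane z =
      (inner ℝ z (BoundaryLRT.dirInterest l P) / ‖BoundaryLRT.dirInterest l P‖) ^ 2 -
        (inner ℝ z (BoundaryLRT.dirNuisance l P) / ‖BoundaryLRT.dirNuisance l P‖) ^ 2) ∧
    (∀ z ∈ BoundaryLRT.region5 l P, BoundaryLRT.distStat l P BoundaryLRT.halfPlane z =
      (inner ℝ z (BoundaryLRT.dirInterest l P) / ‖BoundaryLRT.dirInterest l P‖) ^ 2) ∧
    (0 < BoundaryLRT.corr I → ∀ w₀ w₁ w₂ : ℝ,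
      (stdGaussian Plane).map (BoundaryLRT.distStat l P BoundaryLRT.halfPlane) ≠
        BoundaryLRT.chiBarSq w₀ w₁ w₂) := by
  have hγ : BoundaryLRT.weight I = Real.arcsin (BoundaryLRT.corr I) / (2 * Real.pi) := rfl
  obtain ⟨f, n, a, b, h⟩ := BoundaryLRT.exists_adaptedFrame hI hP hdecomp hρ
  have hW : HasLaw (fun ω => BoundaryLRT.whiten l P (Z ω)) (stdGaussian Plane) μ := by
    have hlaw : HasLaw (BoundaryLRT.whiten l P) (stdGaussian Plane)
        (multivariateGaussian 0 I⁻¹) :=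
      ⟨(LinearMap.continuous_of_finiteDimensional _).measurable.aemeasurable,
        BoundaryLRT.multivariateGaussian_map_toEuclideanLin hI
          (BoundaryLRT.whitening_transpose_mul_self hI hP hdecomp)⟩
    exact hlaw.fun_comp hZ
  have hT : HasLaw
      (fun ω => BoundaryLRT.distStat l P BoundaryLRT.altCone (BoundaryLRT.whiten l P (Z ω)))
      (BoundaryLRT.chiBarSq (1 / 2 - BoundaryLRT.weight I) (1 / 2) (BoundaryLRT.weight I)) μ := by
    have hlaw : HasLaw (BoundaryLRT.distStat l P BoundaryLRT.altCone)
        (BoundaryLRT.chiBarSq (1 / 2 - BoundaryLRT.weight I) (1 / 2) (BoundaryLRT.weight I))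
        (stdGaussian Plane) :=
      ⟨(BoundaryLRT.measurable_distStat l P _).aemeasurable, h.map_distStat_altCone⟩
    exact hlaw.fun_comp hW
  have hne : BoundaryLRT.altCone.Nonempty := ⟨0, by simp [BoundaryLRT.altCone]⟩
  refine ⟨hW, hT, ?_, h.angle_dirInterest_dirNuisance, h.map_region1, h.map_region26,
    h.map_region345, fun z hz => h.distStat_altCone_eq_zero hz,
    fun z hz => h.distStat_halfPlane_eq_altCone hz, fun z hz => h.distStat_halfPlane_region3 hz,
    fun z hz => h.distStat_halfPlane_region4 hz, fun z hz => h.distStat_halfPlane_region5 hz,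
    fun hpos => h.map_distStat_halfPlane_ne (Real.arcsin_pos.2 hpos)⟩
  simp_rw [BoundaryLRT.quadStat_eq_distStat hI hP hdecomp hne]
  exact hT
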